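/- **Setting.** Let $\Omega\subset\mathbb R^2$ be a bounded Lipschitz domain (more generally, a bounded open set) and let $\tau_\bot$ be a conforming triangulation of $\overline\Omega$: a finite set of nondegenerate closed triangles with pairwise disjoint interiors and union $\overline\Omega$, any two different ones of which intersect in the convex hull of their common vertices. Each triangle has one of its vertices assigned as its *newest vertex*, such that an edge shared by $T,T'\in\tau_\bot$ that is opposite to the newest vertex of $T$ is opposite to the newest vertex of $T'$ as well. Newest vertex bisection of $T$ connects the newest vertex to the midpoint of the opposite edge, this midpoint being the newest vertex of both children. Let $\mathcal T$ be the set of all conforming triangulations that result from $\tau_\bot$ by finitely many bisections, and write $\tau\preceq\tau^*$ if $\tau^*$ results from $\tau$ by finitely many bisections. Let $\gamma\subset\Omega$ be a Lipschitz curve (more generally, a Borel set), $ds$ arc length (one-dimensional Hausdorff measure), $f\in L_2(\Omega)$ and $\chi\in L_2(\gamma)$, both real-valued. For $\tau\in\mathcal T$ let $\mathcal N(\tau)$ be its set of vertices. For $z\in\mathcal N(\tau)$ let $\phi_{\tau,z}$ be the continuous piecewise linear function w.r.t. $\tau$ with $\phi_{\tau,z}(z')=\delta_{zz'}$ for $z'\in\mathcal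 N(\tau)$, let $\omega_{\tau,z}:=\operatorname{supp}\phi_{\tau,z}$, let $\Gamma(\omega_{\tau,z})$ be the set of edges of $\tau$ in $\omega_{\tau,z}$ that are not on $\partial\omega_{\tau,z}$, and let $|\omega_{\tau,z}|:=\max\{\operatorname{meas}(T):\tau\ni T\subset\omega_{\tau,z}\}$. Let $\mathbb U_\tau:=\{w\in H^1_0(\Omega): w|_T\in\mathcal P_1(T)\ \forall T\in\tau\}$. For $U:\Omega\to\mathbb R$ whose restriction to each $T\in\tau$ is in $\mathcal P_1(T)$, and $\mathcal M\subset\mathcal N(\tau)$, set $$e(U,f,\chi,\tau,z)^2:=\sum_{e\in\Gamma(\omega_{\tau,z})}|e|^2[\![\nabla U\cdot\mathbf n_e]\!]^2+d_\Omega(f,\tau,z)^2+d_\gamma(\chi,\tau,z)^2,$$ $$d_\Omega(f,\tau,z)^2:=|\omega_{\tau,z}|\int_\Omega|f|^2\phi_{\tau,z}\,dx,\qquad d_\gamma(\chi,\tau,z)^2:=|\omega_{\tau,z}|^{1/2}\int_\gamma|\chi|^2\phi_{\tau,z}\,ds,$$ $$\mathcal E(U,f,\chi,\tau,\mathcal M)^2:=\sum_{z\in\mathcal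 M}e(U,f,\chi,\tau,z)^2,\qquad \mathcal D(f,\chi,\tau)^2:=\sum_{z\in\mathcal N(\tau)}\big(d_\Omega(f,\tau,z)^2+d_\gamma(\chi,\tau,z)^2\big),$$ where $e$, $d_\Omega$, $d_\gamma$, $\mathcal E$, $\mathcal D$ are the nonnegative roots, $[\![\cdot]\!]$ denotes the jump over the edge and $|e|$ its length; put $\mathcal E(U,f,\chi,\tau):=\mathcal E(U,f,\chi,\tau,\mathcal N(\tau))$. Finally, let $\texttt{refine}(\tau,\mathcal M)$ be the smallest (w.r.t. $\preceq$) triangulation in $\mathcal T$ that refines $\tau$ and in which, for each $z\in\mathcal M$, each $\tau\ni T\subset\omega_{\tau,z}$ has been replaced by at least four subtriangles, in the sense that $T$ and both its children have been bisected. **Lemma.** For $\tau\in\mathcal T$, $\mathcal M\subset\mathcal N(\tau)$, $U\in\mathbb U_\tau$ and $\mathcal T\ni\tau^*\succeq\texttt{refine}(\tau,\mathcal M)$, $$\mathcal E(U,f,\chi,\tau^*)^2\le\mathcal E(U,f,\chi,\tau)^2-\tfrac12\,\mathcal E(U,f,\chi,\tau,\mathcal M)^2 .$$ Furthermore, $\mathcal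 D(f,\chi,\tau^*)\le\mathcal D(f,\chi,\tau)$ for all $\tau,\tau^*\in\mathcal T$ with $\tau\preceq\tau^*$. -/

import Mathlib

open MeasureTheory
open scoped ContDiff ENNReal

/-- The Euclidean plane. -/
abbrev Plane := EuclideanSpace ℝ (Fin 2)

/-! ### Triangles and newest vertex bisection -/

/-- A triangle with an assigned newest vertex `newest`. The edge with endpoints `a`, `b`, which is
opposite to the newest vertex, is the one that is bisected. -/
structure Tri where
  newest : Plane
  a : Plane
  b : Plane

namespace Tri

open Classical in
/-- The set of vertices. -/
noncomputable def verts (T : Tri) : Finset Plane := {T.newest, T.a, T.b}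

/-- The (closed) triangle as a point set. -/
def carrier (T : Tri) : Set Plane := convexHull ℝ (T.verts : Set Plane)

/-- The vertices are not collinear. -/
def Nondegenerate (T : Tri) : Prop := AffineIndependent ℝ ![T.newest, T.a, T.b]

open Classical in
/-- The edge opposite to the newest vertex. Edges are given by their two endpoints. -/
noncomputable def bisectionEdge (T : Tri) : Finset Plane := {T.a, T.b}

open Classical in
/-- The three edges. -/
noncomputable def edges (T : Tri) : Finset (Finset Plane) :=
  {T.bisectionEdge, {T.newest, T.a}, {T.newest, T.b}}

open Classical in
/-- The two triangles created by newest vertex bisection: the midpoint of the edge opposite to the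
newest vertex is connected to the newest vertex, and it is the newest vertex of both children. -/
noncomputable def children (T : Tri) : Finset Tri :=
  {⟨midpoint ℝ T.a T.b, T.newest, T.a⟩, ⟨midpoint ℝ T.a T.b, T.newest, T.b⟩}

open Classical in
/-- The four subtriangles that are created by bisecting `T` and both its children. -/
noncomputable def grandchildren (T : Tri) : Finset Tri := T.children.biUnion children

/-- For a triangle with vertices `p`, `q`, `r`, the barycentric coordinate of `x` that belongs to
`p`: the affine function that is `1` at `p`, and `0` at `q` and `r`, as a quotient of signed
areas. -/
noncomputable def baryCoord (p q r x : Plane) : ℝ :=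
  ((q - x) 0 * (r - x) 1 - (q - x) 1 * (r - x) 0) /
    ((q - p) 0 * (r - p) 1 - (q - p) 1 * (r - p) 0)

open Classical in
/-- The affine function on `T` that is `1` at `z` and `0` at the other vertices when `z` is a vertex
of `T`, and the zero function when `z` is not a vertex of `T`. -/
noncomputable def nodal (T : Tri) (z x : Plane) : ℝ :=
  if z = T.newest then baryCoord T.newest T.a T.b x
  else if z = T.a then baryCoord T.a T.b T.newest x
  else if z = T.b then baryCoord T.b T.newest T.a x
  else 0

/-- `n` is the unit normal on the edge `e` of `T` that points out of `T`. -/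
def IsOuterNormal (T : Tri) (e : Finset Plane) (n : Plane) : Prop :=
  ‖n‖ = 1 ∧ (∀ p ∈ e, ∀ q ∈ e, inner ℝ n (q - p) = 0) ∧
    ∀ p ∈ e, ∀ q ∈ T.verts, inner ℝ n (q - p) ≤ 0

/-- The outer unit normal of `T` on its edge `e`. -/
noncomputable def outerNormal (T : Tri) (e : Finset Plane) : Plane :=
  Classical.epsilon (T.IsOuterNormal e)

end Tri

/-- A finite collection of triangles. -/
abbrev Mesh := Finset Tri

namespace Mesh

open Classical in
/-- The set of vertices of the triangles in the collection. -/
noncomputable def nodes (τ : Mesh) : Finset Plane := τ.biUnion Tri.verts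

open Classical in
/-- The set of edges of the triangles in the collection. -/
noncomputable def edges (τ : Mesh) : Finset (Finset Plane) := τ.biUnion Tri.edges

/-- Two different triangles intersect in the convex hull of their common vertices: not at all, in
a common vertex, or in a common edge. -/
def Conforming (τ : Mesh) : Prop :=
  ∀ T ∈ τ, ∀ T' ∈ τ, T ≠ T' →
    T.carrier ∩ T'.carrier = convexHull ℝ ((T.verts : Set Plane) ∩ (T'.verts : Set Plane))

/-- A conforming triangulation of (the closure of) `Ω` into nondegenerate triangles with disjoint
interiors, with an assignment of the newest vertices such that an edge shared by two triangles that
is opposite to the newest vertex of one of them, is so for the other one as well. -/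
structure IsBottom (Ω : Set Plane) (τ : Mesh) : Prop where
  nondegenerate : ∀ T ∈ τ, T.Nondegenerate
  cover : ⋃ T ∈ τ, T.carrier = closure Ω
  disjoint : ∀ T ∈ τ, ∀ T' ∈ τ, T ≠ T' → Disjoint (interior T.carrier) (interior T'.carrier)
  conforming : τ.Conforming
  compatible : ∀ T ∈ τ, ∀ T' ∈ τ, T.bisectionEdge ∈ T'.edges → T'.bisectionEdge = T.bisectionEdge

open Classical in
/-- `τ'` results from `τ` by the bisection of one triangle. -/
def BisectStep (τ τ' : Mesh) : Prop := ∃ T ∈ τ, τ' = τ.erase T ∪ T.children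

/-- `τ'` is a refinement of `τ`: it results from `τ` by a finite number of bisections. -/
def Refines (τ' τ : Mesh) : Prop := Relation.ReflTransGen BisectStep τ τ'

/-- The family of all conforming triangulations that can be created from the bottom triangulation
by newest vertex bisection. -/
def Family (τ₀ : Mesh) : Set Mesh := {τ | τ.Refines τ₀ ∧ τ.Conforming}

open Classical in
/-- The continuous function, piecewise linear w.r.t. `τ`, that is `1` at the vertex `z` and `0` at
all other vertices, extended by zero outside the union of the triangles. For conforming `τ` the
value at `x` does not depend on the choice of the triangle that contains `x`. -/
noncomputable def hat (τ : Mesh) (z x : Plane) : ℝ :=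
  if h : ∃ T ∈ τ, x ∈ T.carrier then h.choose.nodal z x else 0

/-- The patch of `z`: the support of the hat function. -/
def patch (τ : Mesh) (z : Plane) : Set Plane := tsupport (τ.hat z)

open Classical in
/-- The triangles of `τ` that are contained in the patch of `z`. -/
noncomputable def patchTris (τ : Mesh) (z : Plane) : Finset Tri :=
  {T ∈ τ | T.carrier ⊆ τ.patch z}

/-- The largest area of a triangle in the patch of `z`. -/
noncomputable def patchSize (τ : Mesh) (z : Plane) : ℝ :=
  ((τ.patchTris z).sup fun T => (volume T.carrier).toNNReal : NNReal)

open Classical in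
/-- The edges of `τ` in the patch of `z` that are not on the boundary of the patch. -/
noncomputable def patchEdges (τ : Mesh) (z : Plane) : Finset (Finset Plane) :=
  {e ∈ τ.edges | convexHull ℝ (e : Set Plane) ⊆ τ.patch z ∧
    ¬ convexHull ℝ (e : Set Plane) ⊆ frontier (τ.patch z)}

/-- In `ρ`, each triangle `T` of `τ` in a patch of a `z ∈ M` has been replaced by at least four
subtriangles: `T` and its two children have been bisected, so that each triangle of `ρ` inside `T`
is contained in one of the four grandchildren of `T`. -/
def FourfoldRefined (τ : Mesh) (M : Finset Plane) (ρ : Mesh) : Prop :=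
  ∀ z ∈ M, ∀ T ∈ τ.patchTris z, ∀ T' ∈ ρ, T'.carrier ⊆ T.carrier →
    ∃ G ∈ T.grandchildren, T'.carrier ⊆ G.carrier

/-- `ρ` is the output of `refine(τ, M)`: the smallest triangulation in the family that refines `τ`
and in which each triangle in a patch of a marked vertex has been replaced by at least four
subtriangles. -/
def IsRefine (τ₀ τ : Mesh) (M : Finset Plane) (ρ : Mesh) : Prop :=
  (ρ ∈ Family τ₀ ∧ ρ.Refines τ ∧ τ.FourfoldRefined M ρ) ∧
    ∀ ρ' ∈ Family τ₀, ρ'.Refines τ → τ.FourfoldRefined M ρ' → ρ'.Refines ρ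

end Mesh

/-! ### Finite element spaces -/

/-- Membership in `H¹₀(Ω)`, the closure of the smooth functions with compact support in `Ω` w.r.t.
the `H¹(Ω)`-norm; `g` is the weak gradient of `u`. -/
def MemH10 (Ω : Set Plane) (u : Plane → ℝ) : Prop :=
  ∃ g : Plane → Plane, MemLp u 2 (volume.restrict Ω) ∧ MemLp g 2 (volume.restrict Ω) ∧
    ∀ ε : ℝ≥0∞, 0 < ε → ∃ v : Plane → ℝ,
      ContDiff ℝ ∞ v ∧ HasCompactSupport v ∧ tsupport v ⊆ Ω ∧
      eLpNorm (fun x => u x - v x) 2 (volume.restrict Ω) < ε ∧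
      eLpNorm (fun x => g x - gradient v x) 2 (volume.restrict Ω) < ε

/-- On `T`, the function `U` is (almost everywhere) affine with gradient `g`. -/
def IsAffineOn (U : Plane → ℝ) (T : Tri) (g : Plane) : Prop :=
  ∃ c : ℝ, ∀ᵐ x ∂(volume.restrict T.carrier), U x = inner ℝ g x + c

/-- The space of functions in `H¹₀(Ω)` whose restriction to each triangle of `τ` is in `P₁`. -/
def feSpace (Ω : Set Plane) (τ : Mesh) : Set (Plane → ℝ) :=
  {U | MemH10 Ω U ∧ ∀ T ∈ τ, ∃ g, IsAffineOn U T g}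

/-- The (constant) gradient on `T` of a function that is affine on `T`. -/
noncomputable def gradOn (U : Plane → ℝ) (T : Tri) : Plane := Classical.epsilon (IsAffineOn U T)

open Classical in
/-- The jump of the normal derivative of `U` over the edge `e`, as the sum of the derivatives in the
direction of the outer normals of the triangles that share `e`. For the two triangles at an interior
edge these normals are opposite, so that this is the difference of the two normal derivatives. -/
noncomputable def normalJump (U : Plane → ℝ) (τ : Mesh) (e : Finset Plane) : ℝ :=
  ∑ T ∈ τ with e ∈ T.edges, inner ℝ (gradOn U T) (T.outerNormal e)

/-! ### The error estimator and the data oscillation -/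

/-- The local jump term; the length of an edge is the distance of its endpoints. -/
noncomputable def jumpLoc (U : Plane → ℝ) (τ : Mesh) (z : Plane) : ℝ :=
  √(∑ e ∈ τ.patchEdges z, Metric.diam (e : Set Plane) ^ 2 * normalJump U τ e ^ 2)

/-- The local data term of `f` on `Ω`. -/
noncomputable def dOmegaLoc (Ω : Set Plane) (f : Plane → ℝ) (τ : Mesh) (z : Plane) : ℝ :=
  √(τ.patchSize z * ∫ x in Ω, |f x| ^ 2 * τ.hat z x)

/-- The local data term of `χ` on `γ`; the integral is w.r.t. arc length, i.e., the one-dimensional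
Hausdorff measure. -/
noncomputable def dGammaLoc (γ : Set Plane) (χ : Plane → ℝ) (τ : Mesh) (z : Plane) : ℝ :=
  √(√(τ.patchSize z) * ∫ x in γ, |χ x| ^ 2 * τ.hat z x ∂(Measure.hausdorffMeasure 1))

/-- The local error indicator. -/
noncomputable def estLoc (Ω γ : Set Plane) (U f χ : Plane → ℝ) (τ : Mesh) (z : Plane) : ℝ :=
  √(jumpLoc U τ z ^ 2 + dOmegaLoc Ω f τ z ^ 2 + dGammaLoc γ χ τ z ^ 2)

/-- The error estimator over the vertices in `M`. -/
noncomputable def estimator (Ω γ : Set Plane) (U f χ : Plane → ℝ) (τ : Mesh)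
    (M : Finset Plane) : ℝ :=
  √(∑ z ∈ M, estLoc Ω γ U f χ τ z ^ 2)

/-- The data oscillation of `f` over the vertices in `M`. -/
noncomputable def oscOmega (Ω : Set Plane) (f : Plane → ℝ) (τ : Mesh) (M : Finset Plane) : ℝ :=
  √(∑ z ∈ M, dOmegaLoc Ω f τ z ^ 2)

/-- The data oscillation of `χ` over the vertices in `M`. -/
noncomputable def oscGamma (γ : Set Plane) (χ : Plane → ℝ) (τ : Mesh) (M : Finset Plane) : ℝ :=
  √(∑ z ∈ M, dGammaLoc γ χ τ z ^ 2)

/-- The total data oscillation over the vertices in `M`. -/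
noncomputable def dataOscillation (Ω γ : Set Plane) (f χ : Plane → ℝ) (τ : Mesh)
    (M : Finset Plane) : ℝ :=
  √(oscOmega Ω f τ M ^ 2 + oscGamma γ χ τ M ^ 2)

/-!
The estimator is a sum over nodes of jump terms and data terms. Both are compared with their
counterparts on the refined triangulation `τ'` with the weight `1 / 2` at marked nodes and `1` at all
other nodes (`Mesh.weight`); the weighted sum over the nodes of `τ` is the right-hand side of the
estimate (`sum_weight_mul`). The only facts about bisection that enter are that a refinement covers
the same set by nondegenerate triangles with disjoint interiors, each of them contained in a
triangle of `τ` (`Mesh.Refines.nonoverlapping`, `Mesh.Refines.exists_superset`,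
`Mesh.Refines.exists_mem`), and that a grandchild has one quarter of the area of its grandparent
(`Tri.area_grandchildren`) and contains at most half of each of its edges
(`Tri.EdgeVertices.dist_le_half`).

*Data terms.* A coarse hat function is the interpolant of its values at the fine nodes, and the
coarse hat functions add up to one. Hence a sum of fine hat functions with weights `a z'` is
bounded by the sum of the coarse ones with weights `b z`, provided that `a z' ≤ b z` whenever the hat
function of `z` does not vanish at `z'` (`Mesh.IsTriangulation.sum_integral_hat_le`). In that
situation each fine triangle at `z'` is contained in a coarse triangle at `z`, so the patch size
does not increase, and it is divided by at least four if `z` is marked. The factor `1 / 2` of the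
curve term is the square root of `1 / 4`.

*Jump terms.* The edges in the interior of the patch of `z` are the edges with endpoint `z` that are
shared by two triangles (`Mesh.IsTriangulation.mem_patchEdges_iff`), so that each shared edge is
counted twice. Over a fine edge inside a coarse triangle there is no jump; any other shared fine
edge is part of a shared coarse edge `e` with the same jump (`normalJump_refines`). The lengths of
the fine edges in `e` add up to at most `|e|`, and each is at most `|e| / 2` if `e` has a
marked endpoint, so that the sum of their squares is at most `|e| ^ 2`, and at most half of that
in the latter case (`Mesh.IsTriangulation.sum_sq_diam_le`).

The monotonicity of the data oscillation is the bound of the data terms without marked nodes.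
-/

/-! ### Barycentric coordinates -/

/-- Twice the signed area of the triangle with vertices `p`, `q`, `r`. -/
noncomputable def signedArea (p q r : Plane) : ℝ :=
  (q - p) 0 * (r - p) 1 - (q - p) 1 * (r - p) 0

/-- A point of an open set can be moved towards any other point within that set. -/
lemma exists_lineMap_mem {O : Set Plane} (hO : IsOpen O) {x : Plane} (hx : x ∈ O) (y : Plane) :
    ∃ t : ℝ, 0 < t ∧ t < 1 ∧ AffineMap.lineMap x y t ∈ O := by
  have hc : Continuous (fun t : ℝ => (AffineMap.lineMap x y t : Plane)) :=
    AffineMap.lineMap_continuous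
  have h0 : ∀ᶠ t in nhdsWithin (0 : ℝ) (Set.Ioi 0), (AffineMap.lineMap x y t : Plane) ∈ O :=
    (hc.continuousAt.eventually (hO.mem_nhds (by simpa using hx))).filter_mono nhdsWithin_le_nhds
  have h1 : ∀ᶠ t in nhdsWithin (0 : ℝ) (Set.Ioi 0), t ∈ Set.Ioo (0 : ℝ) 1 :=
    Ioo_mem_nhdsGT one_pos
  obtain ⟨t, ht, ht'⟩ := (h0.and h1).exists
  exact ⟨t, ht'.1, ht'.2, ht⟩

namespace Tri

lemma baryCoord_eq (p q r x : Plane) :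
    baryCoord p q r x = signedArea x q r / signedArea p q r := rfl

lemma nondegenerate_iff (T : Tri) :
    T.Nondegenerate ↔ signedArea T.newest T.a T.b ≠ 0 := by
  have h : T.Nondegenerate ↔ LinearIndependent ℝ ![T.a - T.newest, T.b - T.newest] := by
    unfold Nondegenerate
    rw [affineIndependent_iff_linearIndependent_vsub ℝ _ (0 : Fin 3),
      ← linearIndependent_equiv (finSuccAboveEquiv (0 : Fin 3))]
    congr! 1
    ext i j
    fin_cases i <;> fin_cases j <;> rfl
  rw [h, LinearIndependent.pair_iff, signedArea]
  set u := T.a - T.newest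
  set v := T.b - T.newest
  constructor
  · intro hl h0
    obtain ⟨h1, h2⟩ := hl (v 1) (-u 1) (by
      ext i; fin_cases i <;> simp <;> linarith)
    obtain ⟨h3, h4⟩ := hl (v 0) (-u 0) (by
      ext i; fin_cases i <;> simp <;> linarith)
    have hu : u = 0 := by
      ext i; fin_cases i <;> simp <;> linarith
    have := (hl 1 0 (by simp [hu])).1
    norm_num at this
  · intro h0 s t hst
    have e0 : s * u 0 + t * v 0 = 0 := by simpa using congrArg (fun w : Plane => w 0) hst
    have e1 : s * u 1 + t * v 1 = 0 := by simpa using congrArg (fun w : Plane => w 1) hst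
    constructor
    · refine (mul_eq_zero (M₀ := ℝ) (a := s) (b := u 0 * v 1 - u 1 * v 0)).1 ?_ |>.resolve_right h0
      linear_combination v 1 * e0 - v 0 * e1
    · refine (mul_eq_zero (M₀ := ℝ) (a := t) (b := u 0 * v 1 - u 1 * v 0)).1 ?_ |>.resolve_right h0
      linear_combination u 0 * e1 - u 1 * e0

lemma signedArea_rotate (p q r : Plane) : signedArea q r p = signedArea p q r := by
  simp [signedArea]; ring

lemma mem_verts {T : Tri} {v : Plane} : v ∈ T.verts ↔ v = T.newest ∨ v = T.a ∨ v = T.b := by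
  simp [verts]

lemma newest_mem (T : Tri) : T.newest ∈ T.verts := mem_verts.2 (.inl rfl)
lemma a_mem (T : Tri) : T.a ∈ T.verts := mem_verts.2 (.inr (.inl rfl))
lemma b_mem (T : Tri) : T.b ∈ T.verts := mem_verts.2 (.inr (.inr rfl))

lemma Nondegenerate.newest_ne_a {T : Tri} (hT : T.Nondegenerate) : T.newest ≠ T.a := by
  intro h; rw [nondegenerate_iff, h] at hT; exact hT (by simp [signedArea])
lemma Nondegenerate.newest_ne_b {T : Tri} (hT : T.Nondegenerate) : T.newest ≠ T.b := by
  intro h; rw [nondegenerate_iff, h] at hT; exact hT (by simp [signedArea])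
lemma Nondegenerate.a_ne_b {T : Tri} (hT : T.Nondegenerate) : T.a ≠ T.b := by
  intro h; rw [nondegenerate_iff, h] at hT; exact hT (by simp [signedArea]; ring)

/-- `baryCoord` as an affine map. -/
noncomputable def baryMap (p q r : Plane) : Plane →ᵃ[ℝ] ℝ where
  toFun := baryCoord p q r
  linear :=
    { toFun := fun v => (v 1 * (r 0 - q 0) - v 0 * (r 1 - q 1)) / signedArea p q r
      map_add' := fun v w => by simp; ring
      map_smul' := fun c v => by simp; ring }
  map_vadd' x v := by simp [baryCoord_eq, signedArea]; ring

open Classical in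
/-- `nodal` as an affine map. -/
noncomputable def nodalMap (T : Tri) (z : Plane) : Plane →ᵃ[ℝ] ℝ :=
  if z = T.newest then baryMap T.newest T.a T.b
  else if z = T.a then baryMap T.a T.b T.newest
  else if z = T.b then baryMap T.b T.newest T.a
  else 0

lemma coe_nodalMap (T : Tri) (z x : Plane) : T.nodalMap z x = T.nodal z x := by
  unfold nodalMap nodal
  split_ifs <;> rfl

lemma continuous_nodal (T : Tri) (z : Plane) : Continuous (T.nodal z) := by
  have : T.nodal z = T.nodalMap z := by ext x; exact (coe_nodalMap T z x).symm
  rw [this]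
  exact (T.nodalMap z).continuous_of_finiteDimensional

lemma nodal_eq_zero {T : Tri} {z : Plane} (hz : z ∉ T.verts) (x : Plane) : T.nodal z x = 0 := by
  rw [mem_verts] at hz
  push Not at hz
  simp [nodal, hz]

lemma nodal_newest (T : Tri) (x : Plane) :
    T.nodal T.newest x = baryCoord T.newest T.a T.b x := by simp [nodal]

lemma Nondegenerate.nodal_a {T : Tri} (hT : T.Nondegenerate) (x : Plane) :
    T.nodal T.a x = baryCoord T.a T.b T.newest x := by simp [nodal, hT.newest_ne_a.symm]

lemma Nondegenerate.nodal_b {T : Tri} (hT : T.Nondegenerate) (x : Plane) :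
    T.nodal T.b x = baryCoord T.b T.newest T.a x := by
  simp [nodal, hT.newest_ne_b.symm, hT.a_ne_b.symm]

lemma baryCoord_self {p q r : Plane} (h : signedArea p q r ≠ 0) : baryCoord p q r p = 1 :=
  div_self h
lemma baryCoord_left (p q r : Plane) : baryCoord p q r q = 0 := by
  simp [baryCoord_eq, signedArea]
lemma baryCoord_right (p q r : Plane) : baryCoord p q r r = 0 := by
  simp [baryCoord_eq, signedArea]

open Classical in
lemma Nondegenerate.nodal_vertex {T : Tri} (hT : T.Nondegenerate) (z : Plane) {v : Plane}
    (hv : v ∈ T.verts) : T.nodal z v = if z = v then 1 else 0 := by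
  have h := (nondegenerate_iff T).1 hT
  have h1 := hT.newest_ne_a
  have h2 := hT.newest_ne_b
  have h3 := hT.a_ne_b
  have ha : signedArea T.a T.b T.newest ≠ 0 := by rwa [signedArea_rotate]
  have hb : signedArea T.b T.newest T.a ≠ 0 := by rwa [signedArea_rotate, signedArea_rotate]
  by_cases hz : z ∈ T.verts
  · rcases mem_verts.1 hz with rfl | rfl | rfl <;> rcases mem_verts.1 hv with rfl | rfl | rfl <;>
      simp [nodal_newest, hT.nodal_a, hT.nodal_b, baryCoord_self, baryCoord_left, baryCoord_right,
        h, ha, hb, h1, h2, h3, h1.symm, h2.symm, h3.symm]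
  · rw [nodal_eq_zero hz, if_neg]
    rintro rfl
    exact hz hv

lemma Nondegenerate.nodal_self {T : Tri} (hT : T.Nondegenerate) {v : Plane} (hv : v ∈ T.verts) :
    T.nodal v v = 1 := by rw [hT.nodal_vertex v hv, if_pos rfl]

lemma Nondegenerate.nodal_of_ne {T : Tri} (hT : T.Nondegenerate) {z v : Plane}
    (hv : v ∈ T.verts) (h : z ≠ v) : T.nodal z v = 0 := by rw [hT.nodal_vertex z hv, if_neg h]

lemma nodal_newest_eq (T : Tri) (x : Plane) :
    T.nodal T.newest x = signedArea x T.a T.b / signedArea T.newest T.a T.b := by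
  rw [nodal_newest, baryCoord_eq]

lemma Nondegenerate.nodal_a_eq {T : Tri} (hT : T.Nondegenerate) (x : Plane) :
    T.nodal T.a x = signedArea x T.b T.newest / signedArea T.newest T.a T.b := by
  rw [hT.nodal_a, baryCoord_eq, signedArea_rotate T.newest T.a T.b]

lemma Nondegenerate.nodal_b_eq {T : Tri} (hT : T.Nondegenerate) (x : Plane) :
    T.nodal T.b x = signedArea x T.newest T.a / signedArea T.newest T.a T.b := by
  rw [hT.nodal_b, baryCoord_eq, signedArea_rotate T.a T.b T.newest,
    signedArea_rotate T.newest T.a T.b]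

lemma Nondegenerate.sum_verts {E : Type*} [AddCommMonoid E] {T : Tri} (hT : T.Nondegenerate)
    (F : Plane → E) : ∑ v ∈ T.verts, F v = F T.newest + F T.a + F T.b := by
  rw [verts, Finset.sum_insert, Finset.sum_insert, Finset.sum_singleton, add_assoc]
  · simpa using hT.a_ne_b
  · simpa using ⟨hT.newest_ne_a, hT.newest_ne_b⟩

lemma Nondegenerate.card_verts {T : Tri} (hT : T.Nondegenerate) : T.verts.card = 3 := by
  rw [Finset.card_eq_sum_ones, hT.sum_verts]

lemma Nondegenerate.sum_nodal {T : Tri} (hT : T.Nondegenerate) (x : Plane) :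
    ∑ v ∈ T.verts, T.nodal v x = 1 := by
  have h := (nondegenerate_iff T).1 hT
  rw [hT.sum_verts, nodal_newest_eq, hT.nodal_a_eq, hT.nodal_b_eq]
  field_simp
  simp [signedArea]; ring

lemma Nondegenerate.sum_nodal_smul {T : Tri} (hT : T.Nondegenerate) (x : Plane) :
    ∑ v ∈ T.verts, T.nodal v x • v = x := by
  have h := (nondegenerate_iff T).1 hT
  rw [hT.sum_verts, nodal_newest_eq, hT.nodal_a_eq, hT.nodal_b_eq]
  ext i
  fin_cases i <;> simp <;> field_simp <;> simp [signedArea] <;> ring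

/-- An affine function is the combination of its values at the vertices with the barycentric
coordinates as weights. -/
lemma Nondegenerate.affine_eq {T : Tri} (hT : T.Nondegenerate) (A : Plane →ᵃ[ℝ] ℝ) (x : Plane) :
    A x = ∑ v ∈ T.verts, T.nodal v x * A v := by
  have hA : ∀ y, A y = A.linear y + A 0 := fun y => by
    rw [AffineMap.decomp' A]; simp
  have h1 : A.linear x = ∑ v ∈ T.verts, T.nodal v x * A.linear v := by
    conv_lhs => rw [← hT.sum_nodal_smul x]
    simp [map_sum]
  rw [hA x, h1]
  conv_lhs => rw [← one_mul (A 0), ← hT.sum_nodal x, Finset.sum_mul, ← Finset.sum_add_distrib]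
  exact Finset.sum_congr rfl fun v _ => by rw [hA v]; ring

lemma Nondegenerate.nodal_eq_sum {T : Tri} (hT : T.Nondegenerate) (T' : Tri) (z x : Plane) :
    T'.nodal z x = ∑ v ∈ T.verts, T.nodal v x * T'.nodal z v := by
  simpa only [coe_nodalMap] using hT.affine_eq (T'.nodalMap z) x

lemma nodal_lineMap (T : Tri) (z x y : Plane) (t : ℝ) :
    T.nodal z (AffineMap.lineMap x y t) = (1 - t) * T.nodal z x + t * T.nodal z y := by
  rw [← coe_nodalMap, AffineMap.apply_lineMap, coe_nodalMap, coe_nodalMap,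
    AffineMap.lineMap_apply_module]
  simp

/-! ### Triangles as point sets -/

lemma convex_carrier (T : Tri) : Convex ℝ T.carrier := convex_convexHull ℝ _

lemma subset_carrier {T : Tri} {v : Plane} (hv : v ∈ T.verts) : v ∈ T.carrier :=
  subset_convexHull ℝ _ hv

lemma isCompact_carrier (T : Tri) : IsCompact T.carrier :=
  T.verts.finite_toSet.isCompact_convexHull (𝕜 := ℝ)

lemma isClosed_carrier (T : Tri) : IsClosed T.carrier := T.isCompact_carrier.isClosed

lemma convex_nodal_preimage (T : Tri) (z : Plane) {I : Set ℝ} (hI : Convex ℝ I) :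
    Convex ℝ {x | T.nodal z x ∈ I} := by
  have := hI.affine_preimage (T.nodalMap z)
  simpa only [Set.preimage, coe_nodalMap] using this

/-- The face of a triangle that is spanned by a set of its vertices. -/
lemma Nondegenerate.mem_convexHull {T : Tri} (hT : T.Nondegenerate) {S : Finset Plane}
    (hS : S ⊆ T.verts) {x : Plane} : x ∈ convexHull ℝ (S : Set Plane) ↔
      (∀ v ∈ S, 0 ≤ T.nodal v x) ∧ ∀ v ∈ T.verts, v ∉ S → T.nodal v x = 0 := by
  constructor
  · intro hx
    refine ⟨fun v _ => ?_, fun v hv hvS => ?_⟩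
    · refine convexHull_min ?_ (T.convex_nodal_preimage v (convex_Ici 0)) hx
      intro w hw
      have := hT.nodal_vertex v (hS hw)
      simp only [Set.mem_ofPred_eq, Set.mem_Ici, this]
      split_ifs <;> norm_num
    · refine convexHull_min ?_ (T.convex_nodal_preimage v (convex_singleton 0)) hx
      intro w hw
      exact hT.nodal_of_ne (hS hw) (fun h => hvS (h ▸ hw))
  · rintro ⟨h1, h2⟩
    rw [Finset.mem_convexHull']
    refine ⟨fun v => T.nodal v x, h1, ?_, ?_⟩
    · rw [Finset.sum_subset hS h2, hT.sum_nodal]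
    · rw [Finset.sum_subset hS fun v hv hvS => by simp [h2 v hv hvS], hT.sum_nodal_smul]

lemma Nondegenerate.mem_carrier {T : Tri} (hT : T.Nondegenerate) {x : Plane} :
    x ∈ T.carrier ↔ ∀ v ∈ T.verts, 0 ≤ T.nodal v x := by
  rw [carrier, hT.mem_convexHull subset_rfl]
  exact ⟨fun h => h.1, fun h => ⟨h, fun v hv hv' => absurd hv hv'⟩⟩

lemma Nondegenerate.nodal_nonneg {T : Tri} (hT : T.Nondegenerate) {x : Plane} (hx : x ∈ T.carrier)
    (z : Plane) : 0 ≤ T.nodal z x := by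
  by_cases hz : z ∈ T.verts
  · exact hT.mem_carrier.1 hx z hz
  · rw [nodal_eq_zero hz]

lemma Nondegenerate.nodal_le_one {T : Tri} (hT : T.Nondegenerate) {x : Plane} (hx : x ∈ T.carrier)
    (z : Plane) : T.nodal z x ≤ 1 := by
  by_cases hz : z ∈ T.verts
  · rw [← hT.sum_nodal x]
    exact Finset.single_le_sum (f := fun v => T.nodal v x) (fun v _ => hT.nodal_nonneg hx v) hz
  · rw [nodal_eq_zero hz]; norm_num

lemma Nondegenerate.mem_interior {T : Tri} (hT : T.Nondegenerate) {x : Plane}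
    (hx : ∀ v ∈ T.verts, 0 < T.nodal v x) : x ∈ interior T.carrier := by
  rw [_root_.mem_interior]
  refine ⟨⋂ v ∈ T.verts, {y | 0 < T.nodal v y}, ?_, ?_, ?_⟩
  · intro y hy
    simp only [Set.mem_iInter] at hy
    exact hT.mem_carrier.2 fun v hv => (hy v hv).le
  · exact T.verts.finite_toSet.isOpen_biInter
      fun v _ => isOpen_lt continuous_const (T.continuous_nodal v)
  · simpa only [Set.mem_iInter, Set.mem_ofPred_eq] using hx

/-- The barycentre. -/
noncomputable def centroid (T : Tri) : Plane := (1 / 3 : ℝ) • (T.newest + T.a + T.b)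

lemma Nondegenerate.nodal_centroid {T : Tri} (hT : T.Nondegenerate) {v : Plane}
    (hv : v ∈ T.verts) : T.nodal v T.centroid = 1 / 3 := by
  have h := (nondegenerate_iff T).1 hT
  have h1 : signedArea T.centroid T.a T.b = 1 / 3 * signedArea T.newest T.a T.b := by
    simp [signedArea, centroid]; ring
  have h2 : signedArea T.centroid T.b T.newest = 1 / 3 * signedArea T.newest T.a T.b := by
    simp [signedArea, centroid]; ring
  have h3 : signedArea T.centroid T.newest T.a = 1 / 3 * signedArea T.newest T.a T.b := by
    simp [signedArea, centroid]; ring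
  rcases mem_verts.1 hv with rfl | rfl | rfl
  · rw [nodal_newest_eq, h1]; field_simp
  · rw [hT.nodal_a_eq, h2]; field_simp
  · rw [hT.nodal_b_eq, h3]; field_simp

lemma Nondegenerate.centroid_mem_interior {T : Tri} (hT : T.Nondegenerate) :
    T.centroid ∈ interior T.carrier :=
  hT.mem_interior fun v hv => by rw [hT.nodal_centroid hv]; norm_num

/-! ### The children of a triangle -/

lemma mem_children {T C : Tri} : C ∈ T.children ↔
    C = ⟨midpoint ℝ T.a T.b, T.newest, T.a⟩ ∨ C = ⟨midpoint ℝ T.a T.b, T.newest, T.b⟩ := by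
  simp [children]

lemma Nondegenerate.children {T C : Tri} (hT : T.Nondegenerate) (hC : C ∈ T.children) :
    C.Nondegenerate := by
  rw [nondegenerate_iff] at hT ⊢
  rcases mem_children.1 hC with rfl | rfl
  · have : signedArea (midpoint ℝ T.a T.b) T.newest T.a
        = 1 / 2 * signedArea T.newest T.a T.b := by
      simp [signedArea, midpoint_eq_smul_add]; ring
    dsimp only
    rw [this]; simpa using hT
  · have : signedArea (midpoint ℝ T.a T.b) T.newest T.b
        = -(1 / 2) * signedArea T.newest T.a T.b := by
      simp [signedArea, midpoint_eq_smul_add]; ring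
    dsimp only
    rw [this]; simpa using hT

lemma midpoint_mem (T : Tri) : midpoint ℝ T.a T.b ∈ T.carrier := by
  rw [midpoint_eq_smul_add, smul_add]
  exact T.convex_carrier (subset_carrier T.a_mem) (subset_carrier T.b_mem) (by norm_num)
    (by norm_num) (by norm_num)

lemma children_subset {T C : Tri} (hC : C ∈ T.children) : C.carrier ⊆ T.carrier := by
  refine convexHull_min ?_ T.convex_carrier
  intro v hv
  rcases mem_children.1 hC with rfl | rfl <;> rcases mem_verts.1 hv with rfl | rfl | rfl
  exacts [T.midpoint_mem, subset_carrier T.newest_mem, subset_carrier T.a_mem,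
    T.midpoint_mem, subset_carrier T.newest_mem, subset_carrier T.b_mem]

lemma combination_mem (T : Tri) {s t u : ℝ} (hs : 0 ≤ s) (ht : 0 ≤ t) (hu : 0 ≤ u)
    (h : s + t + u = 1) : s • T.newest + t • T.a + u • T.b ∈ T.carrier := by
  have := T.convex_carrier.sum_mem (t := (Finset.univ : Finset (Fin 3)))
      (w := ![s, t, u]) (z := ![T.newest, T.a, T.b])
      (by intro i _; fin_cases i <;> simpa)
      (by simpa [Fin.sum_univ_three])
      (by intro i _; fin_cases i; exacts [subset_carrier T.newest_mem, subset_carrier T.a_mem,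
        subset_carrier T.b_mem])
  simpa [Fin.sum_univ_three] using this

/-- The children cover their parent. -/
lemma Nondegenerate.exists_children {T : Tri} (hT : T.Nondegenerate) {x : Plane}
    (hx : x ∈ T.carrier) : ∃ C ∈ T.children, x ∈ C.carrier := by
  have hs := hT.sum_nodal x
  have hx' := hT.sum_nodal_smul x
  rw [hT.sum_verts] at hs hx'
  have hn := hT.nodal_nonneg hx T.newest
  have ha := hT.nodal_nonneg hx T.a
  have hb := hT.nodal_nonneg hx T.b
  set s := T.nodal T.newest x
  set t := T.nodal T.a x
  set u := T.nodal T.b x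
  rcases le_total u t with h | h
  · refine ⟨⟨midpoint ℝ T.a T.b, T.newest, T.a⟩, mem_children.2 (.inl rfl), ?_⟩
    convert combination_mem _ (show 0 ≤ 2 * u by linarith) hn (sub_nonneg.2 h)
      (by linarith) using 1
    rw [← hx']
    simp only [midpoint_eq_smul_add, invOf_eq_inv]
    module
  · refine ⟨⟨midpoint ℝ T.a T.b, T.newest, T.b⟩, mem_children.2 (.inr rfl), ?_⟩
    convert combination_mem _ (show 0 ≤ 2 * t by linarith) hn (sub_nonneg.2 h)
      (by linarith) using 1
    rw [← hx']
    simp only [midpoint_eq_smul_add, invOf_eq_inv]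
    module

lemma nodal_midpoint (T : Tri) (z x y : Plane) :
    T.nodal z (midpoint ℝ x y) = (T.nodal z x + T.nodal z y) / 2 := by
  have := T.nodal_lineMap z x y (1 / 2)
  rw [midpoint, show (⅟2 : ℝ) = 1 / 2 by norm_num, this]; ring

/-- The line through the newest vertex and the midpoint of the opposite edge separates the
children. -/
lemma Nondegenerate.disjoint_children {T C C' : Tri} (hT : T.Nondegenerate)
    (hC : C ∈ T.children) (hC' : C' ∈ T.children) (hne : C ≠ C') :
    Disjoint (interior C.carrier) (interior C'.carrier) := by
  wlog h : C = ⟨midpoint ℝ T.a T.b, T.newest, T.a⟩ generalizing C C'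
  · have h2 := (mem_children.1 hC).resolve_left h
    refine (this hC' hC hne.symm ?_).symm
    exact (mem_children.1 hC').resolve_right fun h' => hne (h2.trans h'.symm)
  have h' := (mem_children.1 hC').resolve_left fun h' => hne (h.trans h'.symm)
  have side : ∀ (D : Tri) (w w' : Plane), D.verts ⊆ {midpoint ℝ T.a T.b, T.newest, w} →
      (w = T.a ∧ w' = T.b ∨ w = T.b ∧ w' = T.a) →
      ∀ x ∈ D.carrier, T.nodal w' x ≤ T.nodal w x := by
    intro D w w' hD hw x hx
    have hcv : Convex ℝ {x | T.nodal w' x ≤ T.nodal w x} := by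
      have := (convex_Ici (0 : ℝ)).affine_preimage (T.nodalMap w - T.nodalMap w')
      refine (congrArg (Convex ℝ) (Set.ext fun x => ?_)).mpr this
      simp [coe_nodalMap]
    refine convexHull_min ?_ hcv hx
    intro v hv
    have := hD hv
    simp only [Finset.mem_insert, Finset.mem_singleton] at this
    rcases hw with ⟨rfl, rfl⟩ | ⟨rfl, rfl⟩ <;> rcases this with rfl | rfl | rfl <;>
      simp [nodal_midpoint, hT.nodal_vertex, mem_verts, hT.newest_ne_a, hT.newest_ne_b,
        hT.a_ne_b, hT.a_ne_b.symm, hT.newest_ne_a.symm, hT.newest_ne_b.symm]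
  have h1 := side C T.a T.b (by subst h; simp [verts]) (.inl ⟨rfl, rfl⟩)
  have h2 := side C' T.b T.a (by subst h'; simp [verts]) (.inr ⟨rfl, rfl⟩)
  rw [Set.disjoint_left]
  intro x hx hx'
  -- Both coordinates agree on the intersection of the interiors, whereas their difference
  -- increases on the way from `x` to `T.a`.
  obtain ⟨t, ht0, ht1, ht⟩ := exists_lineMap_mem (isOpen_interior.inter isOpen_interior)
    (Set.mem_inter hx hx') T.a
  have e1 := le_antisymm (h1 x (interior_subset hx)) (h2 x (interior_subset hx'))
  have e2 := h2 _ (interior_subset ht.2)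
  rw [nodal_lineMap, nodal_lineMap, hT.nodal_self T.a_mem,
    hT.nodal_of_ne T.a_mem hT.a_ne_b.symm, e1] at e2
  linarith

end Tri

namespace Tri

/-! ### Areas and grandchildren -/

/-- The area of a triangle is a fixed multiple (in fact, one half) of the absolute value of
`signedArea`. -/
lemma area_eq (T : Tri) : volume.real T.carrier = |signedArea T.newest T.a T.b| *
    volume.real (convexHull ℝ {0, EuclideanSpace.single 0 1, EuclideanSpace.single 1 1} :
      Set Plane) := by
  set S : Set Plane := convexHull ℝ {0, EuclideanSpace.single 0 1, EuclideanSpace.single 1 1}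
  set u := T.a - T.newest
  set v := T.b - T.newest
  set L : Plane →ₗ[ℝ] Plane := Matrix.toLpLin 2 2 !![u 0, v 0; u 1, v 1]
  have hdet : LinearMap.det L = signedArea T.newest T.a T.b := by
    have : LinearMap.det L = (!![u 0, v 0; u 1, v 1] : Matrix (Fin 2) (Fin 2) ℝ).det := by
      simp [L]
    rw [this, Matrix.det_fin_two_of, signedArea]; ring
  have hL : (fun y => T.newest + y) ⁻¹' T.carrier = L '' S := by
    have h1 : T.carrier = (AffineMap.const ℝ Plane T.newest + L.toAffineMap) '' S := by
      rw [AffineMap.image_convexHull]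
      simp only [carrier, verts, Finset.coe_insert, Finset.coe_singleton, Set.image_insert_eq,
        Set.image_singleton]
      congr 2
      · simp
      · congr 1
        · ext i; fin_cases i <;> simp [L, u, Matrix.toLpLin_apply]
        · congr 1; ext i; fin_cases i <;> simp [L, v, Matrix.toLpLin_apply]
    ext y
    simp [h1]
  rw [measureReal_def, ← measure_preimage_add volume T.newest, hL,
    Measure.addHaar_image_linearMap, ENNReal.toReal_mul, hdet,
    ENNReal.toReal_ofReal (abs_nonneg _), measureReal_def]

lemma volume_ne_top (T : Tri) : volume T.carrier ≠ ⊤ := T.isCompact_carrier.measure_ne_top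

lemma area_mono {T T' : Tri} (h : T'.carrier ⊆ T.carrier) :
    volume.real T'.carrier ≤ volume.real T.carrier := measureReal_mono h T.volume_ne_top

lemma area_children {T C : Tri} (hC : C ∈ T.children) :
    volume.real C.carrier = 1 / 2 * volume.real T.carrier := by
  rw [area_eq, area_eq, ← mul_assoc]
  congr 1
  rcases mem_children.1 hC with rfl | rfl
  · rw [show signedArea (midpoint ℝ T.a T.b) T.newest T.a
        = 1 / 2 * signedArea T.newest T.a T.b by
      simp [signedArea, midpoint_eq_smul_add]; ring, abs_mul]
    norm_num
  · rw [show signedArea (midpoint ℝ T.a T.b) T.newest T.b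
        = -(1 / 2) * signedArea T.newest T.a T.b by
      simp [signedArea, midpoint_eq_smul_add]; ring, abs_mul]
    norm_num

lemma mem_grandchildren {T G : Tri} :
    G ∈ T.grandchildren ↔ ∃ C ∈ T.children, G ∈ C.children := by
  simp [grandchildren]

lemma area_grandchildren {T G : Tri} (hG : G ∈ T.grandchildren) :
    volume.real G.carrier = 1 / 4 * volume.real T.carrier := by
  obtain ⟨C, hC, hG⟩ := mem_grandchildren.1 hG
  rw [area_children hG, area_children hC]; ring

/-- On a grandchild, one of any two of the barycentric coordinates stays on one side of `1 / 2`. -/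
lemma Nondegenerate.grandchildren_half {T G : Tri} (hT : T.Nondegenerate)
    (hG : G ∈ T.grandchildren) {p q : Plane} (hp : p ∈ T.verts) (hq : q ∈ T.verts) (hpq : p ≠ q) :
    ∃ w, (w = p ∨ w = q) ∧ ((∀ x ∈ G.carrier, T.nodal w x ≤ 1 / 2) ∨
      ∀ x ∈ G.carrier, 1 / 2 ≤ T.nodal w x) := by
  have hle : ∀ w, (∀ v ∈ G.verts, T.nodal w v ≤ 1 / 2) → ∀ x ∈ G.carrier, T.nodal w x ≤ 1 / 2 :=
    fun w h x hx => convexHull_min (fun v hv => h v hv)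
      (T.convex_nodal_preimage w (convex_Iic (1 / 2))) hx
  have hge : ∀ w, (∀ v ∈ G.verts, 1 / 2 ≤ T.nodal w v) → ∀ x ∈ G.carrier, 1 / 2 ≤ T.nodal w x :=
    fun w h x hx => convexHull_min (fun v hv => h v hv)
      (T.convex_nodal_preimage w (convex_Ici (1 / 2))) hx
  have h1 := hT.newest_ne_a
  have h2 := hT.newest_ne_b
  have h3 := hT.a_ne_b
  -- A grandchild that contains the newest vertex stays away from both other vertices, the
  -- other grandchildren stay away from the newest vertex and close to one of the others.
  have key : ((∀ v ∈ G.verts, T.nodal T.a v ≤ 1 / 2) ∧ ∀ v ∈ G.verts, T.nodal T.b v ≤ 1 / 2) ∨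
      (∀ v ∈ G.verts, T.nodal T.newest v ≤ 1 / 2) ∧
        ((∀ v ∈ G.verts, 1 / 2 ≤ T.nodal T.a v) ∨ ∀ v ∈ G.verts, 1 / 2 ≤ T.nodal T.b v) := by
    obtain ⟨C, hC, hG⟩ := mem_grandchildren.1 hG
    have n1 := hT.nodal_self T.newest_mem
    have n2 := hT.nodal_self T.a_mem
    have n3 := hT.nodal_self T.b_mem
    have n4 := hT.nodal_of_ne T.a_mem h1
    have n5 := hT.nodal_of_ne T.b_mem h2
    have n6 := hT.nodal_of_ne T.newest_mem h1.symm
    have n7 := hT.nodal_of_ne T.newest_mem h2.symm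
    have n8 := hT.nodal_of_ne T.b_mem h3
    have n9 := hT.nodal_of_ne T.a_mem h3.symm
    rcases mem_children.1 hC with rfl | rfl <;> rcases mem_children.1 hG with rfl | rfl
    · left
      simp only [mem_verts, forall_eq_or_imp, forall_eq, nodal_midpoint]
      norm_num [n1, n2, n3, n4, n5, n6, n7, n8, n9]
    · right
      refine ⟨?_, .inl ?_⟩ <;>
      simp only [mem_verts, forall_eq_or_imp, forall_eq, nodal_midpoint] <;>
      norm_num [n1, n2, n3, n4, n5, n6, n7, n8, n9]
    · left
      simp only [mem_verts, forall_eq_or_imp, forall_eq, nodal_midpoint]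
      norm_num [n1, n2, n3, n4, n5, n6, n7, n8, n9]
    · right
      refine ⟨?_, .inr ?_⟩ <;>
      simp only [mem_verts, forall_eq_or_imp, forall_eq, nodal_midpoint] <;>
      norm_num [n1, n2, n3, n4, n5, n6, n7, n8, n9]
  rcases key with ⟨ha, hb⟩ | ⟨hn, hab⟩
  · rcases mem_verts.1 hp with rfl | rfl | rfl
    · rcases mem_verts.1 hq with rfl | rfl | rfl
      exacts [absurd rfl hpq, ⟨_, .inr rfl, .inl (hle _ ha)⟩, ⟨_, .inr rfl, .inl (hle _ hb)⟩]
    exacts [⟨_, .inl rfl, .inl (hle _ ha)⟩, ⟨_, .inl rfl, .inl (hle _ hb)⟩]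
  · by_cases hpn : p = T.newest
    · exact ⟨p, .inl rfl, .inl (hle _ (hpn ▸ hn))⟩
    by_cases hqn : q = T.newest
    · exact ⟨q, .inr rfl, .inl (hle _ (hqn ▸ hn))⟩
    have hp' := (mem_verts.1 hp).resolve_left hpn
    have hq' := (mem_verts.1 hq).resolve_left hqn
    rcases hab with h | h
    · refine ⟨T.a, ?_, .inr (hge _ h)⟩
      rcases hp' with rfl | rfl
      · exact .inl rfl
      · rcases hq' with rfl | rfl
        exacts [.inr rfl, absurd rfl hpq]
    · refine ⟨T.b, ?_, .inr (hge _ h)⟩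
      rcases hp' with rfl | rfl
      · rcases hq' with rfl | rfl
        exacts [absurd rfl hpq, .inr rfl]
      · exact .inl rfl

end Tri

namespace Mesh

/-! ### Refinements -/

/-- The triangles are nondegenerate and have disjoint interiors. -/
structure Nonoverlapping (τ : Mesh) : Prop where
  nondegenerate : ∀ T ∈ τ, T.Nondegenerate
  disjoint : ∀ T ∈ τ, ∀ T' ∈ τ, T ≠ T' → Disjoint (interior T.carrier) (interior T'.carrier)

lemma Nonoverlapping.eq_of_subset {τ : Mesh} (hτ : τ.Nonoverlapping) {T₁ T₂ T : Tri}
    (h₁ : T₁ ∈ τ) (h₂ : T₂ ∈ τ) (hT : T.Nondegenerate) (hs₁ : T.carrier ⊆ T₁.carrier)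
    (hs₂ : T.carrier ⊆ T₂.carrier) : T₁ = T₂ := by
  by_contra hne
  exact Set.disjoint_left.1 (hτ.disjoint T₁ h₁ T₂ h₂ hne)
    (interior_mono hs₁ hT.centroid_mem_interior) (interior_mono hs₂ hT.centroid_mem_interior)

lemma BisectStep.nonoverlapping {τ τ' : Mesh} (h : BisectStep τ τ') (hτ : τ.Nonoverlapping) :
    τ'.Nonoverlapping := by
  classical
  obtain ⟨T, hT, rfl⟩ := h
  have hTn := hτ.nondegenerate T hT
  constructor
  · intro C hC
    rcases Finset.mem_union.1 hC with hC | hC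
    · exact hτ.nondegenerate C (Finset.mem_of_mem_erase hC)
    · exact hTn.children hC
  · have mixed : ∀ A ∈ τ.erase T, ∀ C ∈ T.children,
        Disjoint (interior A.carrier) (interior C.carrier) := fun A hA C hC =>
      (hτ.disjoint A (Finset.mem_of_mem_erase hA) T hT (Finset.ne_of_mem_erase hA)).mono_right
        (interior_mono (Tri.children_subset hC))
    intro A hA C hC hne
    rcases Finset.mem_union.1 hA with hA | hA <;> rcases Finset.mem_union.1 hC with hC | hC
    · exact hτ.disjoint _ (Finset.mem_of_mem_erase hA) _ (Finset.mem_of_mem_erase hC) hne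
    · exact mixed A hA C hC
    · exact (mixed C hC A hA).symm
    · exact hTn.disjoint_children hA hC hne

lemma BisectStep.exists_superset {τ τ' : Mesh} (h : BisectStep τ τ') {T' : Tri} (hT' : T' ∈ τ') :
    ∃ T ∈ τ, T'.carrier ⊆ T.carrier := by
  classical
  obtain ⟨T, hT, rfl⟩ := h
  rcases Finset.mem_union.1 hT' with h | h
  · exact ⟨T', Finset.mem_of_mem_erase h, subset_rfl⟩
  · exact ⟨T, hT, Tri.children_subset h⟩

lemma BisectStep.exists_mem {τ τ' : Mesh} (h : BisectStep τ τ') (hτ : τ.Nonoverlapping)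
    {x : Plane} (hx : ∃ T ∈ τ, x ∈ T.carrier) : ∃ T ∈ τ', x ∈ T.carrier := by
  classical
  obtain ⟨T, hT, rfl⟩ := h
  obtain ⟨A, hA, hx⟩ := hx
  by_cases hAT : A = T
  · subst hAT
    obtain ⟨C, hC, hx⟩ := (hτ.nondegenerate A hA).exists_children hx
    exact ⟨C, Finset.mem_union_right _ hC, hx⟩
  · exact ⟨A, Finset.mem_union_left _ (Finset.mem_erase.2 ⟨hAT, hA⟩), hx⟩

lemma Refines.nonoverlapping {τ τ' : Mesh} (h : τ'.Refines τ) (hτ : τ.Nonoverlapping) :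
    τ'.Nonoverlapping := by
  induction h with
  | refl => exact hτ
  | tail _ h ih => exact h.nonoverlapping ih

lemma Refines.exists_superset {τ τ' : Mesh} (h : τ'.Refines τ) {T' : Tri} (hT' : T' ∈ τ') :
    ∃ T ∈ τ, T'.carrier ⊆ T.carrier := by
  induction h generalizing T' with
  | refl => exact ⟨T', hT', subset_rfl⟩
  | tail _ h ih =>
    obtain ⟨A, hA, hs⟩ := h.exists_superset hT'
    obtain ⟨T, hT, hs'⟩ := ih hA
    exact ⟨T, hT, hs.trans hs'⟩

lemma Refines.exists_mem {τ τ' : Mesh} (h : τ'.Refines τ) (hτ : τ.Nonoverlapping)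
    {x : Plane} (hx : ∃ T ∈ τ, x ∈ T.carrier) : ∃ T ∈ τ', x ∈ T.carrier := by
  induction h with
  | refl => exact hx
  | tail h' h ih => exact h.exists_mem (Refines.nonoverlapping h' hτ) ih

lemma IsBottom.nonoverlapping {Ω : Set Plane} {τ : Mesh} (h : IsBottom Ω τ) : τ.Nonoverlapping :=
  ⟨h.nondegenerate, h.disjoint⟩

lemma mem_patchTris {τ : Mesh} {z : Plane} {T : Tri} :
    T ∈ τ.patchTris z ↔ T ∈ τ ∧ T.carrier ⊆ τ.patch z := by
  simp [patchTris]

/-- Being refined into grandchildren is inherited by finer triangulations. -/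
lemma FourfoldRefined.refines {τ ρ τ' : Mesh} {M : Finset Plane} (h : τ.FourfoldRefined M ρ)
    (hτ : τ.Nonoverlapping) (hρ : ρ.Refines τ) (hτ' : τ'.Refines ρ) :
    τ.FourfoldRefined M τ' := by
  intro z hz T hT T' hT' hs
  obtain ⟨R, hR, hsR⟩ := hτ'.exists_superset hT'
  obtain ⟨T₂, hT₂, hs₂⟩ := hρ.exists_superset hR
  have hn := (hτ'.nonoverlapping (hρ.nonoverlapping hτ)).nondegenerate T' hT'
  obtain rfl := hτ.eq_of_subset hT₂ (mem_patchTris.1 hT).1 hn (hsR.trans hs₂) hs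
  obtain ⟨G, hG, hsG⟩ := h z hz T₂ hT R hR hs₂
  exact ⟨G, hG, hsR.trans hsG⟩

end Mesh

namespace Mesh

/-! ### Hat functions and patches -/

/-- A conforming collection of nondegenerate triangles with disjoint interiors. -/
structure IsTriangulation (τ : Mesh) : Prop extends Nonoverlapping τ where
  conforming : τ.Conforming

lemma mem_nodes {τ : Mesh} {z : Plane} : z ∈ τ.nodes ↔ ∃ T ∈ τ, z ∈ T.verts := by
  simp [nodes]

variable {τ τ' : Mesh}

/-- A point in the intersection of two triangles, in terms of barycentric coordinates: those that
belong to vertices that are not shared vanish. -/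
lemma IsTriangulation.nodal_eq_zero (hτ : τ.IsTriangulation) {T T' : Tri} (hT : T ∈ τ)
    (hT' : T' ∈ τ) {x : Plane} (hx : x ∈ T.carrier) (hx' : x ∈ T'.carrier) {v : Plane}
    (hv : v ∉ T'.verts) : T.nodal v x = 0 := by
  classical
  by_cases hne : T = T'
  · subst hne; exact Tri.nodal_eq_zero hv x
  have h : x ∈ convexHull ℝ ((T.verts : Set Plane) ∩ T'.verts) :=
    hτ.conforming T hT T' hT' hne ▸ ⟨hx, hx'⟩
  rw [← Finset.coe_inter,
    (hτ.nondegenerate T hT).mem_convexHull Finset.inter_subset_left] at h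
  by_cases hvT : v ∈ T.verts
  · exact h.2 v hvT fun h => hv (Finset.mem_inter.1 h).2
  · exact Tri.nodal_eq_zero hvT x

lemma IsTriangulation.nodal_eq (hτ : τ.IsTriangulation) {T T' : Tri} (hT : T ∈ τ)
    (hT' : T' ∈ τ) {x : Plane} (hx : x ∈ T.carrier) (hx' : x ∈ T'.carrier) (z : Plane) :
    T'.nodal z x = T.nodal z x := by
  have hTn := hτ.nondegenerate T hT
  have hTn' := hτ.nondegenerate T' hT'
  by_cases hz : z ∈ T'.verts
  · rw [hTn.nodal_eq_sum T' z x]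
    by_cases hzT : z ∈ T.verts
    · rw [Finset.sum_eq_single_of_mem z hzT, hTn'.nodal_self hz, mul_one]
      intro v _ hvz
      by_cases hv : v ∈ T'.verts
      · rw [hTn'.nodal_of_ne hv hvz.symm, mul_zero]
      · rw [hτ.nodal_eq_zero hT hT' hx hx' hv, zero_mul]
    · rw [Tri.nodal_eq_zero hzT]
      refine Finset.sum_eq_zero fun v hv => ?_
      by_cases hv' : v ∈ T'.verts
      · rw [hTn'.nodal_of_ne hv' (fun h : z = v => hzT (h ▸ hv)), mul_zero]
      · rw [hτ.nodal_eq_zero hT hT' hx hx' hv', zero_mul]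
  · rw [Tri.nodal_eq_zero hz, hτ.nodal_eq_zero hT hT' hx hx' hz]

lemma IsTriangulation.hat_eq (hτ : τ.IsTriangulation) {T : Tri} (hT : T ∈ τ) {x : Plane}
    (hx : x ∈ T.carrier) (z : Plane) : τ.hat z x = T.nodal z x := by
  have h : ∃ T ∈ τ, x ∈ T.carrier := ⟨T, hT, hx⟩
  rw [hat, dif_pos h]
  exact hτ.nodal_eq hT h.choose_spec.1 hx h.choose_spec.2 z

lemma hat_eq_zero {x : Plane} (hx : ¬ ∃ T ∈ τ, x ∈ T.carrier) (z : Plane) : τ.hat z x = 0 := by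
  rw [hat, dif_neg hx]

lemma IsTriangulation.hat_nonneg (hτ : τ.IsTriangulation) (z x : Plane) : 0 ≤ τ.hat z x := by
  by_cases hx : ∃ T ∈ τ, x ∈ T.carrier
  · obtain ⟨T, hT, hx⟩ := hx
    rw [hτ.hat_eq hT hx]
    exact (hτ.nondegenerate T hT).nodal_nonneg hx z
  · rw [hat_eq_zero hx]

lemma IsTriangulation.hat_le_one (hτ : τ.IsTriangulation) (z x : Plane) : τ.hat z x ≤ 1 := by
  by_cases hx : ∃ T ∈ τ, x ∈ T.carrier
  · obtain ⟨T, hT, hx⟩ := hx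
    rw [hτ.hat_eq hT hx]
    exact (hτ.nondegenerate T hT).nodal_le_one hx z
  · rw [hat_eq_zero hx]; norm_num

lemma IsTriangulation.continuousOn_hat (hτ : τ.IsTriangulation) (z : Plane) :
    ContinuousOn (τ.hat z) (⋃ T ∈ τ, T.carrier) := by
  have h : ContinuousOn (τ.hat z) (⋃ T : τ, (T : Tri).carrier) :=
    (locallyFinite_of_finite _).continuousOn_iUnion (fun T => T.1.isClosed_carrier) fun T =>
      ((T.1.continuous_nodal z).continuousOn).congr fun x hx => hτ.hat_eq T.2 hx z
  rwa [Set.iUnion_subtype] at h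

/-- The hat functions are a partition of unity. -/
lemma IsTriangulation.sum_hat (hτ : τ.IsTriangulation) {T : Tri} (hT : T ∈ τ) {x : Plane}
    (hx : x ∈ T.carrier) : ∑ z ∈ τ.nodes, τ.hat z x = 1 := by
  rw [← (hτ.nondegenerate T hT).sum_nodal x]
  simp_rw [hτ.hat_eq hT hx]
  exact (Finset.sum_subset (fun v hv => mem_nodes.2 ⟨T, hT, hv⟩)
    fun v _ hv => Tri.nodal_eq_zero hv x).symm

/-- A coarse hat function is the interpolant of its values at the fine nodes. -/
lemma IsTriangulation.hat_eq_sum (hτ : τ.IsTriangulation) (hτ' : τ'.IsTriangulation)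
    (h : τ'.Refines τ) (z : Plane) {x : Plane} (hx : ∃ T ∈ τ', x ∈ T.carrier) :
    τ.hat z x = ∑ v ∈ τ'.nodes, τ.hat z v * τ'.hat v x := by
  obtain ⟨T', hT', hx⟩ := hx
  obtain ⟨T, hT, hs⟩ := h.exists_superset hT'
  rw [hτ.hat_eq hT (hs hx), (hτ'.nondegenerate T' hT').nodal_eq_sum]
  simp_rw [hτ'.hat_eq hT' hx]
  rw [← Finset.sum_subset (fun v hv => mem_nodes.2 ⟨T', hT', hv⟩ : T'.verts ⊆ τ'.nodes)
    fun v _ hv => by rw [Tri.nodal_eq_zero hv, mul_zero]]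
  exact Finset.sum_congr rfl fun v hv => by
    rw [hτ.hat_eq hT (hs (Tri.subset_carrier hv)), mul_comm]

lemma IsTriangulation.patch_eq (hτ : τ.IsTriangulation) (z : Plane) :
    τ.patch z = ⋃ T ∈ {T ∈ (τ : Set Tri) | z ∈ T.verts}, T.carrier := by
  apply Set.Subset.antisymm
  · refine closure_minimal ?_ ((τ.finite_toSet.subset (Set.sep_subset _ _)).isClosed_biUnion
      fun T _ => T.isClosed_carrier)
    intro x hx
    have hx' : ∃ T ∈ τ, x ∈ T.carrier := by
      by_contra h; exact hx (hat_eq_zero h z)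
    obtain ⟨T, hT, hxT⟩ := hx'
    refine Set.mem_biUnion (x := T) ⟨hT, ?_⟩ hxT
    by_contra hz
    exact hx (by rw [hτ.hat_eq hT hxT, Tri.nodal_eq_zero hz])
  · refine Set.iUnion₂_subset fun T ⟨hT, hz⟩ x hx => ?_
    have hTn := hτ.nondegenerate T hT
    rw [patch, tsupport, mem_closure_iff]
    intro O hO hxO
    obtain ⟨t, ht0, ht1, ht⟩ := exists_lineMap_mem hO hxO z
    refine ⟨_, ht, ?_⟩
    have hm : AffineMap.lineMap x z t ∈ T.carrier :=
      T.convex_carrier.segment_subset hx (Tri.subset_carrier hz)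
        (segment_eq_image_lineMap ℝ x z ▸ ⟨t, ⟨ht0.le, ht1.le⟩, rfl⟩)
    rw [Function.mem_support, hτ.hat_eq hT hm, Tri.nodal_lineMap, hTn.nodal_self hz]
    have := mul_nonneg (sub_nonneg.2 ht1.le) (hTn.nodal_nonneg hx z)
    linarith

lemma IsTriangulation.mem_patch (hτ : τ.IsTriangulation) {z x : Plane} :
    x ∈ τ.patch z ↔ ∃ T ∈ τ, z ∈ T.verts ∧ x ∈ T.carrier := by
  simp only [hτ.patch_eq, Set.mem_iUnion, exists_prop, Set.mem_ofPred_eq, and_assoc,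
    Finset.mem_coe]

lemma IsTriangulation.mem_patchTris_iff (hτ : τ.IsTriangulation) {z : Plane} {T : Tri} :
    T ∈ τ.patchTris z ↔ T ∈ τ ∧ z ∈ T.verts := by
  rw [mem_patchTris]
  refine and_congr_right fun hT => ⟨fun h => ?_, fun hz x hx => hτ.mem_patch.2 ⟨T, hT, hz, hx⟩⟩
  have hTn := hτ.nondegenerate T hT
  have hc := interior_subset hTn.centroid_mem_interior
  obtain ⟨T', hT', hz, hc'⟩ := hτ.mem_patch.1 (h hc)
  have hs : T.verts ⊆ T'.verts := by
    intro v hv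
    by_contra hv'
    have h0 := hτ.nodal_eq_zero hT hT' hc hc' hv'
    rw [hTn.nodal_centroid hv] at h0
    norm_num at h0
  rw [Finset.eq_of_subset_of_card_le hs
    (by rw [hTn.card_verts, (hτ.nondegenerate T' hT').card_verts])]
  exact hz

lemma patchSize_nonneg (τ : Mesh) (z : Plane) : 0 ≤ τ.patchSize z := NNReal.coe_nonneg _

lemma area_le_patchSize {z : Plane} {T : Tri} (hT : T ∈ τ.patchTris z) :
    volume.real T.carrier ≤ τ.patchSize z := by
  have := Finset.le_sup (f := fun T : Tri => (volume T.carrier).toNNReal) hT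
  exact_mod_cast this

lemma patchSize_le {z : Plane} {c : ℝ} (hc : 0 ≤ c)
    (h : ∀ T ∈ τ.patchTris z, volume.real T.carrier ≤ c) : τ.patchSize z ≤ c := by
  lift c to NNReal using hc
  refine NNReal.coe_le_coe.2 (Finset.sup_le fun T hT => ?_)
  exact_mod_cast h T hT

/-- The patch of a fine node `z'` is at most as large as that of a coarse node `z` whose hat
function does not vanish at `z'`. -/
lemma IsTriangulation.patchSize_le_of_hat_ne_zero (hτ : τ.IsTriangulation)
    (hτ' : τ'.IsTriangulation) (h : τ'.Refines τ) {z z' : Plane} (hz : τ.hat z z' ≠ 0) :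
    τ'.patchSize z' ≤ τ.patchSize z := by
  refine patchSize_le (patchSize_nonneg _ _) fun T' hT' => ?_
  obtain ⟨hT', hz'⟩ := hτ'.mem_patchTris_iff.1 hT'
  obtain ⟨T, hT, hs⟩ := h.exists_superset hT'
  rw [hτ.hat_eq hT (hs (Tri.subset_carrier hz'))] at hz
  refine (Tri.area_mono hs).trans (area_le_patchSize (hτ.mem_patchTris_iff.2 ⟨hT, ?_⟩))
  by_contra hzT
  exact hz (Tri.nodal_eq_zero hzT z')

lemma IsTriangulation.patchSize_le_quarter (hτ : τ.IsTriangulation)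
    (hτ' : τ'.IsTriangulation) (h : τ'.Refines τ) {M : Finset Plane}
    (hM : τ.FourfoldRefined M τ') {z z' : Plane} (hzM : z ∈ M) (hz : τ.hat z z' ≠ 0) :
    τ'.patchSize z' ≤ 1 / 4 * τ.patchSize z := by
  refine patchSize_le (mul_nonneg (by norm_num) (patchSize_nonneg _ _)) fun T' hT' => ?_
  obtain ⟨hT', hz'⟩ := hτ'.mem_patchTris_iff.1 hT'
  obtain ⟨T, hT, hs⟩ := h.exists_superset hT'
  rw [hτ.hat_eq hT (hs (Tri.subset_carrier hz'))] at hz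
  have hTz : T ∈ τ.patchTris z := by
    refine hτ.mem_patchTris_iff.2 ⟨hT, ?_⟩
    by_contra hzT
    exact hz (Tri.nodal_eq_zero hzT z')
  obtain ⟨G, hG, hsG⟩ := hM z hzM T hTz T' hT' hs
  refine (Tri.area_mono hsG).trans ?_
  rw [Tri.area_grandchildren hG]
  exact mul_le_mul_of_nonneg_left (area_le_patchSize hTz) (by norm_num)

/-! ### Monotonicity of the data terms -/

/-- The weight with which the contribution of a node enters the bound for the refined
triangulation: `1 / 2` at marked nodes, and `1` elsewhere. -/
noncomputable def weight (M : Finset Plane) (z : Plane) : ℝ := by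
  classical exact if z ∈ M then 1 / 2 else 1

/-- Weighted integrals against hat functions, when each of the fine weights is bounded by
the coarse weights at the nodes whose hat functions do not vanish there. -/
lemma IsTriangulation.sum_integral_hat_le (hτ : τ.IsTriangulation) (hτ' : τ'.IsTriangulation)
    (h : τ'.Refines τ) {μ : Measure Plane} {S : Set Plane} (hS : MeasurableSet S)
    (hSτ : ∀ x ∈ S, ∃ T ∈ τ, x ∈ T.carrier) {F : Plane → ℝ} (hF : Integrable F (μ.restrict S))
    (hF0 : ∀ x, 0 ≤ F x) {a b : Plane → ℝ}
    (hab : ∀ z ∈ τ.nodes, ∀ z' ∈ τ'.nodes, τ.hat z z' ≠ 0 → a z' ≤ b z) :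
    ∑ z' ∈ τ'.nodes, a z' * ∫ x in S, F x * τ'.hat z' x ∂μ ≤
      ∑ z ∈ τ.nodes, b z * ∫ x in S, F x * τ.hat z x ∂μ := by
  have hint : ∀ {σ : Mesh}, σ.IsTriangulation → (∀ x ∈ S, ∃ T ∈ σ, x ∈ T.carrier) → ∀ z,
      Integrable (fun x => F x * σ.hat z x) (μ.restrict S) := by
    intro σ hσ hSσ z
    refine hF.mul_bdd (c := 1) ?_ (Filter.Eventually.of_forall fun x => ?_)
    · refine ((hσ.continuousOn_hat z).mono fun x hx => ?_).aestronglyMeasurable hS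
      simpa using hSσ x hx
    · rw [Real.norm_of_nonneg (hσ.hat_nonneg z x)]
      exact hσ.hat_le_one z x
  have hSτ' : ∀ x ∈ S, ∃ T ∈ τ', x ∈ T.carrier := fun x hx =>
    h.exists_mem hτ.toNonoverlapping (hSτ x hx)
  simp_rw [← integral_const_mul]
  rw [← integral_finsetSum _ fun z _ => (hint hτ' hSτ' z).const_mul _,
    ← integral_finsetSum _ fun z _ => (hint hτ hSτ z).const_mul _]
  refine setIntegral_mono_on (integrable_finsetSum _ fun z _ => (hint hτ' hSτ' z).const_mul _)
    (integrable_finsetSum _ fun z _ => (hint hτ hSτ z).const_mul _) hS fun x hx => ?_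
  have key : ∑ z' ∈ τ'.nodes, a z' * τ'.hat z' x ≤ ∑ z ∈ τ.nodes, b z * τ.hat z x := by
    calc ∑ z' ∈ τ'.nodes, a z' * τ'.hat z' x
        = ∑ z' ∈ τ'.nodes, ∑ z ∈ τ.nodes, a z' * (τ.hat z z' * τ'.hat z' x) := by
          refine Finset.sum_congr rfl fun z' hz' => ?_
          obtain ⟨T', hT', hv⟩ := mem_nodes.1 hz'
          obtain ⟨T, hT, hs⟩ := h.exists_superset hT'
          rw [← Finset.mul_sum, ← Finset.sum_mul, hτ.sum_hat hT (hs (Tri.subset_carrier hv)),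
            one_mul]
      _ ≤ ∑ z' ∈ τ'.nodes, ∑ z ∈ τ.nodes, b z * (τ.hat z z' * τ'.hat z' x) := by
          refine Finset.sum_le_sum fun z' hz' => Finset.sum_le_sum fun z hz => ?_
          by_cases h0 : τ.hat z z' = 0
          · simp [h0]
          · exact mul_le_mul_of_nonneg_right (hab z hz z' hz' h0)
              (mul_nonneg (hτ.hat_nonneg _ _) (hτ'.hat_nonneg _ _))
      _ = ∑ z ∈ τ.nodes, b z * τ.hat z x := by
          rw [Finset.sum_comm]
          refine Finset.sum_congr rfl fun z _ => ?_
          rw [← Finset.mul_sum, ← hτ.hat_eq_sum hτ' h z (hSτ' x hx)]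
  calc ∑ z' ∈ τ'.nodes, a z' * (F x * τ'.hat z' x)
      = F x * ∑ z' ∈ τ'.nodes, a z' * τ'.hat z' x := by
        rw [Finset.mul_sum]; exact Finset.sum_congr rfl fun _ _ => by ring
    _ ≤ F x * ∑ z ∈ τ.nodes, b z * τ.hat z x := mul_le_mul_of_nonneg_left key (hF0 x)
    _ = ∑ z ∈ τ.nodes, b z * (F x * τ.hat z x) := by
        rw [Finset.mul_sum]; exact Finset.sum_congr rfl fun _ _ => by ring

end Mesh

open Mesh

lemma sq_dOmegaLoc (Ω : Set Plane) (f : Plane → ℝ) {τ : Mesh} (hτ : τ.IsTriangulation)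
    (z : Plane) : dOmegaLoc Ω f τ z ^ 2 = τ.patchSize z * ∫ x in Ω, |f x| ^ 2 * τ.hat z x :=
  Real.sq_sqrt (mul_nonneg (patchSize_nonneg _ _)
    (integral_nonneg fun _ => mul_nonneg (sq_nonneg _) (hτ.hat_nonneg _ _)))

lemma sq_dGammaLoc (γ : Set Plane) (χ : Plane → ℝ) {τ : Mesh} (hτ : τ.IsTriangulation)
    (z : Plane) : dGammaLoc γ χ τ z ^ 2 =
      √(τ.patchSize z) * ∫ x in γ, |χ x| ^ 2 * τ.hat z x ∂(Measure.hausdorffMeasure 1) :=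
  Real.sq_sqrt (mul_nonneg (Real.sqrt_nonneg _)
    (integral_nonneg fun _ => mul_nonneg (sq_nonneg _) (hτ.hat_nonneg _ _)))

lemma sum_sq_dOmegaLoc_le {Ω : Set Plane} (hΩ : MeasurableSet Ω) {f : Plane → ℝ}
    (hf : MemLp f 2 (volume.restrict Ω)) {τ τ' : Mesh} (hτ : τ.IsTriangulation)
    (hΩτ : ∀ x ∈ Ω, ∃ T ∈ τ, x ∈ T.carrier) (hτ' : τ'.IsTriangulation) (h : τ'.Refines τ)
    {M : Finset Plane} (hM : τ.FourfoldRefined M τ') :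
    ∑ z ∈ τ'.nodes, dOmegaLoc Ω f τ' z ^ 2 ≤
      ∑ z ∈ τ.nodes, weight M z * dOmegaLoc Ω f τ z ^ 2 := by
  simp_rw [sq_dOmegaLoc Ω f hτ, sq_dOmegaLoc Ω f hτ', ← mul_assoc]
  refine hτ.sum_integral_hat_le hτ' h hΩ hΩτ (by simpa using hf.integrable_sq)
    (fun x => sq_nonneg _) fun z _ z' _ hz => ?_
  unfold weight
  split_ifs with hzM
  · have := hτ.patchSize_le_quarter hτ' h hM hzM hz
    have := patchSize_nonneg τ z
    linarith
  · rw [one_mul]; exact hτ.patchSize_le_of_hat_ne_zero hτ' h hz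

lemma sum_sq_dGammaLoc_le {γ : Set Plane} (hγ : MeasurableSet γ) {χ : Plane → ℝ}
    (hχ : MemLp χ 2 ((Measure.hausdorffMeasure 1).restrict γ)) {τ τ' : Mesh}
    (hτ : τ.IsTriangulation) (hγτ : ∀ x ∈ γ, ∃ T ∈ τ, x ∈ T.carrier) (hτ' : τ'.IsTriangulation)
    (h : τ'.Refines τ) {M : Finset Plane} (hM : τ.FourfoldRefined M τ') :
    ∑ z ∈ τ'.nodes, dGammaLoc γ χ τ' z ^ 2 ≤
      ∑ z ∈ τ.nodes, weight M z * dGammaLoc γ χ τ z ^ 2 := by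
  simp_rw [sq_dGammaLoc γ χ hτ, sq_dGammaLoc γ χ hτ', ← mul_assoc]
  refine hτ.sum_integral_hat_le hτ' h hγ hγτ (by simpa using hχ.integrable_sq)
    (fun x => sq_nonneg _) fun z _ z' _ hz => ?_
  unfold weight
  split_ifs with hzM
  · have h4 := Real.sqrt_le_sqrt (hτ.patchSize_le_quarter hτ' h hM hzM hz)
    rwa [Real.sqrt_mul (by norm_num), show (1 / 4 : ℝ) = (1 / 2) ^ 2 by norm_num,
      Real.sqrt_sq (by norm_num)] at h4
  · rw [one_mul]; exact Real.sqrt_le_sqrt (hτ.patchSize_le_of_hat_ne_zero hτ' h hz)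

namespace Tri

/-! ### Edges of a triangle -/

lemma Nondegenerate.mem_edges {T : Tri} (hT : T.Nondegenerate) {e : Finset Plane} :
    e ∈ T.edges ↔ e ⊆ T.verts ∧ e.card = 2 := by
  classical
  have h1 := hT.newest_ne_a
  have h2 := hT.newest_ne_b
  have h3 := hT.a_ne_b
  simp only [edges, bisectionEdge, Finset.mem_insert, Finset.mem_singleton]
  constructor
  · rintro (rfl | rfl | rfl)
    · exact ⟨by intro v; simp [mem_verts]; tauto, by convert Finset.card_pair h3⟩
    · exact ⟨by intro v; simp [mem_verts]; tauto, by convert Finset.card_pair h1⟩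
    · exact ⟨by intro v; simp [mem_verts]; tauto, by convert Finset.card_pair h2⟩
  · rintro ⟨hs, hc⟩
    obtain ⟨p, q, hpq, rfl⟩ := Finset.card_eq_two.1 hc
    have hp := mem_verts.1 (hs (Finset.mem_insert_self p _))
    have hq := mem_verts.1 (hs (Finset.mem_insert_of_mem (Finset.mem_singleton_self q)))
    rcases hp with rfl | rfl | rfl <;> rcases hq with rfl | rfl | rfl <;>
      simp_all [Finset.ext_iff] <;> grind

/-- An edge with its endpoints and the opposite vertex. -/
structure EdgeVertices (T : Tri) (e : Finset Plane) (p q r : Plane) : Prop where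
  p_ne_q : p ≠ q
  p_ne_r : p ≠ r
  q_ne_r : q ≠ r
  mem_edge : ∀ v, v ∈ e ↔ v = p ∨ v = q
  mem_tri : ∀ v, v ∈ T.verts ↔ v = p ∨ v = q ∨ v = r

lemma Nondegenerate.exists_edgeVertices {T : Tri} (hT : T.Nondegenerate) {e : Finset Plane}
    (he : e ∈ T.edges) : ∃ p q r, T.EdgeVertices e p q r := by
  classical
  obtain ⟨hs, hc⟩ := hT.mem_edges.1 he
  obtain ⟨p, q, hpq, rfl⟩ := Finset.card_eq_two.1 hc
  have h1 : (T.verts \ {p, q}).card = 1 := by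
    rw [Finset.card_sdiff_of_subset hs, hT.card_verts, hc]
  obtain ⟨r, hr⟩ := Finset.card_eq_one.1 h1
  have hr' : r ∈ T.verts \ {p, q} := hr ▸ Finset.mem_singleton_self r
  simp only [Finset.mem_sdiff, Finset.mem_insert, Finset.mem_singleton, not_or] at hr'
  refine ⟨p, q, r, hpq, Ne.symm hr'.2.1, Ne.symm hr'.2.2, by simp, fun v => ?_⟩
  rw [← Finset.sdiff_union_of_subset hs, hr]
  simp; tauto

namespace EdgeVertices

variable {T : Tri} {e : Finset Plane} {p q r : Plane}

lemma eq_pair (h : T.EdgeVertices e p q r) : (e : Set Plane) = {p, q} := by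
  ext v; simp [h.mem_edge]

lemma p_mem (h : T.EdgeVertices e p q r) : p ∈ e := (h.mem_edge p).2 (.inl rfl)
lemma q_mem (h : T.EdgeVertices e p q r) : q ∈ e := (h.mem_edge q).2 (.inr rfl)
lemma p_mem_verts (h : T.EdgeVertices e p q r) : p ∈ T.verts := (h.mem_tri p).2 (.inl rfl)
lemma q_mem_verts (h : T.EdgeVertices e p q r) : q ∈ T.verts := (h.mem_tri q).2 (.inr (.inl rfl))
lemma r_mem_verts (h : T.EdgeVertices e p q r) : r ∈ T.verts := (h.mem_tri r).2 (.inr (.inr rfl))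
lemma r_notMem (h : T.EdgeVertices e p q r) : r ∉ e := by
  rw [h.mem_edge]; rintro (h' | h')
  exacts [h.p_ne_r h'.symm, h.q_ne_r h'.symm]
lemma subset_verts (h : T.EdgeVertices e p q r) : e ⊆ T.verts := fun v hv =>
  (h.mem_tri v).2 (((h.mem_edge v).1 hv).imp_right .inl)

lemma swap (h : T.EdgeVertices e p q r) : T.EdgeVertices e q p r :=
  ⟨h.p_ne_q.symm, h.q_ne_r, h.p_ne_r, fun v => by rw [h.mem_edge, or_comm],
    fun v => by rw [h.mem_tri, or_left_comm]⟩

lemma card (h : T.EdgeVertices e p q r) : e.card = 2 := by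
  rw [show e = {p, q} by ext v; simp [h.mem_edge]]
  exact Finset.card_pair h.p_ne_q

lemma sum_verts {E : Type*} [AddCommMonoid E] (h : T.EdgeVertices e p q r) (F : Plane → E) :
    ∑ v ∈ T.verts, F v = F p + F q + F r := by
  rw [show T.verts = {p, q, r} by ext v; simp [h.mem_tri], Finset.sum_insert, Finset.sum_insert,
    Finset.sum_singleton, add_assoc]
  · simpa using h.q_ne_r
  · simpa using ⟨h.p_ne_q, h.p_ne_r⟩

lemma diam_eq (h : T.EdgeVertices e p q r) : Metric.diam (e : Set Plane) = dist p q := by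
  rw [h.eq_pair, Metric.diam_pair]

lemma mem_convexHull (h : T.EdgeVertices e p q r) (hT : T.Nondegenerate) {x : Plane} :
    x ∈ convexHull ℝ (e : Set Plane) ↔ x ∈ T.carrier ∧ T.nodal r x = 0 := by
  rw [hT.mem_convexHull h.subset_verts, hT.mem_carrier]
  constructor
  · rintro ⟨h1, h2⟩
    have h0 := h2 r h.r_mem_verts h.r_notMem
    refine ⟨fun v hv => ?_, h0⟩
    by_cases hve : v ∈ e
    exacts [h1 v hve, (h2 v hv hve).ge]
  · rintro ⟨h1, h2⟩
    refine ⟨fun v hv => h1 v (h.subset_verts hv), fun v hv hve => ?_⟩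
    rw [h.mem_edge] at hve
    rcases (h.mem_tri v).1 hv with rfl | rfl | rfl
    exacts [absurd (.inl rfl) hve, absurd (.inr rfl) hve, h2]

lemma sum_nodal (h : T.EdgeVertices e p q r) (hT : T.Nondegenerate) (x : Plane) :
    T.nodal p x + T.nodal q x + T.nodal r x = 1 := by
  rw [← hT.sum_nodal x, h.sum_verts]

lemma sum_nodal_smul (h : T.EdgeVertices e p q r) (hT : T.Nondegenerate) (x : Plane) :
    T.nodal p x • p + T.nodal q x • q + T.nodal r x • r = x := by
  conv_rhs => rw [← hT.sum_nodal_smul x]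
  rw [h.sum_verts]

/-- The coordinate that vanishes on an edge is determined up to a factor. -/
lemma nodal_eq_mul (h : T.EdgeVertices e p q r) (hT : T.Nondegenerate) {T' : Tri} {r' : Plane}
    (hp : T'.nodal r' p = 0) (hq : T'.nodal r' q = 0) (x : Plane) :
    T'.nodal r' x = T.nodal r x * T'.nodal r' r := by
  rw [hT.nodal_eq_sum T' r' x, h.sum_verts, hp, hq]; ring

lemma dist_eq (h : T.EdgeVertices e p q r) (hT : T.Nondegenerate) {s t : Plane}
    (hs : s ∈ convexHull ℝ (e : Set Plane)) (ht : t ∈ convexHull ℝ (e : Set Plane)) :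
    dist s t = |T.nodal p s - T.nodal p t| * dist p q := by
  have hs0 := ((h.mem_convexHull hT).1 hs).2
  have ht0 := ((h.mem_convexHull hT).1 ht).2
  have hs1 := h.sum_nodal hT s
  have ht1 := h.sum_nodal hT t
  have : s - t = (T.nodal p s - T.nodal p t) • (p - q) := by
    conv_lhs => rw [← h.sum_nodal_smul hT s, ← h.sum_nodal_smul hT t]
    rw [hs0, ht0, show T.nodal q s = 1 - T.nodal p s by linarith,
      show T.nodal q t = 1 - T.nodal p t by linarith]
    module
  rw [dist_eq_norm, this, norm_smul, Real.norm_eq_abs, dist_eq_norm]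

/-- The part of an edge that is contained in a grandchild is at most half of that edge. -/
lemma dist_le_half (h : T.EdgeVertices e p q r) (hT : T.Nondegenerate) {G : Tri}
    (hG : G ∈ T.grandchildren) {s t : Plane} (hs : s ∈ convexHull ℝ (e : Set Plane))
    (ht : t ∈ convexHull ℝ (e : Set Plane)) (hsG : s ∈ G.carrier) (htG : t ∈ G.carrier) :
    dist s t ≤ 1 / 2 * Metric.diam (e : Set Plane) := by
  obtain ⟨w, hw, hwG⟩ := hT.grandchildren_half hG h.p_mem_verts h.q_mem_verts h.p_ne_q
  wlog hwp : w = p generalizing p q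
  · exact this h.swap hw.symm (hw.resolve_left hwp)
  subst hwp
  rw [h.dist_eq hT hs ht, h.diam_eq]
  refine mul_le_mul_of_nonneg_right ?_ dist_nonneg
  have hsT := ((h.mem_convexHull hT).1 hs).1
  have htT := ((h.mem_convexHull hT).1 ht).1
  have s0 := hT.nodal_nonneg hsT w
  have s1 := hT.nodal_le_one hsT w
  have t0 := hT.nodal_nonneg htT w
  have t1 := hT.nodal_le_one htT w
  rw [abs_le]
  rcases hwG with hwG | hwG
  · have := hwG s hsG; have := hwG t htG
    constructor <;> linarith
  · have := hwG s hsG; have := hwG t htG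
    constructor <;> linarith

end EdgeVertices

/-! ### Outer normals -/

variable {T : Tri} {e : Finset Plane} {p q r : Plane}

/-- Given a direction `n` that is orthogonal to an edge, the component in that direction of the
position relative to the edge is proportional to the barycentric coordinate of the opposite
vertex. -/
lemma EdgeVertices.inner_eq (h : T.EdgeVertices e p q r) (hT : T.Nondegenerate) {n : Plane}
    (hn : inner ℝ n (q - p) = 0) (x : Plane) :
    inner ℝ n (x - p) = T.nodal r x * inner ℝ n (r - p) := by
  have h1 := h.sum_nodal hT x
  have : x - p = T.nodal q x • (q - p) + T.nodal r x • (r - p) := by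
    conv_lhs => rw [← h.sum_nodal_smul hT x]
    rw [show T.nodal p x = 1 - T.nodal q x - T.nodal r x by linarith]
    module
  rw [this, inner_add_right, inner_smul_right, inner_smul_right, hn]; ring

lemma EdgeVertices.isOuterNormal_iff (h : T.EdgeVertices e p q r) {n : Plane} :
    T.IsOuterNormal e n ↔ ‖n‖ = 1 ∧ inner ℝ n (q - p) = 0 ∧ inner ℝ n (r - p) ≤ 0 := by
  refine and_congr_right fun _ => ⟨fun ⟨h1, h2⟩ => ⟨h1 p h.p_mem q h.q_mem,
    h2 p h.p_mem r h.r_mem_verts⟩, fun ⟨h1, h2⟩ => ?_⟩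
  have h1' : inner ℝ n (p - q) = 0 := by rw [← neg_sub, inner_neg_right, h1, neg_zero]
  have h2' : inner ℝ n (r - q) ≤ 0 := by
    rw [show r - q = (r - p) + (p - q) by abel, inner_add_right, h1', add_zero]; exact h2
  constructor
  · intro a ha b hb
    rcases (h.mem_edge a).1 ha with rfl | rfl <;> rcases (h.mem_edge b).1 hb with rfl | rfl <;>
      simp [h1, h1']
  · intro a ha b hb
    rcases (h.mem_edge a).1 ha with rfl | rfl <;>
      rcases (h.mem_tri b).1 hb with rfl | rfl | rfl <;> simp [h1, h1', h2, h2']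

lemma EdgeVertices.isOuterNormal_unique (h : T.EdgeVertices e p q r) (hT : T.Nondegenerate)
    {n n' : Plane} (hn : T.IsOuterNormal e n) (hn' : T.IsOuterNormal e n') : n = n' := by
  obtain ⟨h1, h2, h3⟩ := h.isOuterNormal_iff.1 hn
  obtain ⟨h1', h2', h3'⟩ := h.isOuterNormal_iff.1 hn'
  set α := inner ℝ n (r - p)
  set α' := inner ℝ n' (r - p)
  have hin : ∀ w, inner ℝ n w = T.nodal r (p + w) * α := fun w => by
    simpa using h.inner_eq hT h2 (p + w)
  have hin' : ∀ w, inner ℝ n' w = T.nodal r (p + w) * α' := fun w => by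
    simpa using h.inner_eq hT h2' (p + w)
  have key : α' • n = α • n' := by
    refine ext_inner_right ℝ fun w => ?_
    rw [real_inner_smul_left, real_inner_smul_left, hin, hin']; ring
  have habs : |α'| = |α| := by simpa [norm_smul, h1, h1'] using congrArg norm key
  rw [abs_of_nonpos h3, abs_of_nonpos h3', neg_inj] at habs
  have hα : α ≠ 0 := by
    intro h0
    have : n = 0 := ext_inner_right ℝ fun w => by rw [hin, h0, mul_zero, inner_zero_left]
    rw [this] at h1; simp at h1
  rw [habs] at key
  exact smul_right_injective _ hα key

lemma EdgeVertices.exists_isOuterNormal (h : T.EdgeVertices e p q r) (hT : T.Nondegenerate) :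
    ∃ n, T.IsOuterNormal e n := by
  -- The coordinate that belongs to the opposite vertex decreases in the direction `g`.
  set L : Plane →ₗ[ℝ] ℝ := (T.nodalMap r).linear
  set g : Plane := -(InnerProductSpace.toDual ℝ Plane).symm L.toContinuousLinearMap
  have hg : ∀ x y, inner ℝ g (x - y) = T.nodal r y - T.nodal r x := by
    intro x y
    have : L (x - y) = T.nodal r x - T.nodal r y := by
      simpa [coe_nodalMap, L] using (T.nodalMap r).linearMap_vsub x y
    simp only [g, inner_neg_left, InnerProductSpace.toDual_symm_apply,
      LinearMap.coe_toContinuousLinearMap', this]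
    ring
  have hp := hT.nodal_of_ne h.p_mem_verts h.p_ne_r.symm
  have hq := hT.nodal_of_ne h.q_mem_verts h.q_ne_r.symm
  have hr := hT.nodal_self h.r_mem_verts
  have hg0 : ‖g‖ ≠ 0 := by
    intro h0
    have := hg r p
    rw [norm_eq_zero.1 h0, inner_zero_left, hp, hr] at this
    norm_num at this
  refine ⟨‖g‖⁻¹ • g, h.isOuterNormal_iff.2 ⟨?_, ?_, ?_⟩⟩
  · rw [norm_smul, norm_inv, norm_norm, inv_mul_cancel₀ hg0]
  · rw [real_inner_smul_left, hg, hp, hq]; simp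
  · rw [real_inner_smul_left, hg, hp, hr]; simp

lemma EdgeVertices.outerNormal_eq (h : T.EdgeVertices e p q r) (hT : T.Nondegenerate)
    {n : Plane} (hn : T.IsOuterNormal e n) : T.outerNormal e = n :=
  h.isOuterNormal_unique hT (Classical.epsilon_spec ⟨n, hn⟩) hn

lemma EdgeVertices.isOuterNormal_outerNormal (h : T.EdgeVertices e p q r)
    (hT : T.Nondegenerate) : T.IsOuterNormal e (T.outerNormal e) :=
  Classical.epsilon_spec (h.exists_isOuterNormal hT)

/-- The outer normal does not change when passing to a smaller triangle on the same side of a part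
of the edge. -/
lemma EdgeVertices.outerNormal_eq_of_subset (h : T.EdgeVertices e p q r) (hT : T.Nondegenerate)
    {T' : Tri} (hT' : T'.Nondegenerate) {e' : Finset Plane} (he' : e' ∈ T'.edges)
    (hs : T'.carrier ⊆ T.carrier) (hse : (e' : Set Plane) ⊆ convexHull ℝ (e : Set Plane)) :
    T'.outerNormal e' = T.outerNormal e := by
  obtain ⟨p', q', r', h'⟩ := hT'.exists_edgeVertices he'
  obtain ⟨h1, h2, h3⟩ := h.isOuterNormal_iff.1 (h.isOuterNormal_outerNormal hT)
  have hp' := ((h.mem_convexHull hT).1 (hse h'.p_mem)).2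
  have hq' := ((h.mem_convexHull hT).1 (hse h'.q_mem)).2
  have ip := h.inner_eq hT h2 p'
  have iq := h.inner_eq hT h2 q'
  have ir := h.inner_eq hT h2 r'
  rw [hp', zero_mul] at ip
  rw [hq', zero_mul] at iq
  refine h'.outerNormal_eq hT' (h'.isOuterNormal_iff.2 ⟨h1, ?_, ?_⟩)
  · rw [← sub_sub_sub_cancel_right q' p' p, inner_sub_right, ip, iq, sub_zero]
  · rw [← sub_sub_sub_cancel_right r' p' p, inner_sub_right, ip, ir, sub_zero]
    exact mul_nonpos_of_nonneg_of_nonpos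
      (hT.nodal_nonneg (hs (subset_carrier h'.r_mem_verts)) r) h3

end Tri

namespace Mesh

/-! ### Two triangles that share an edge -/

open Tri

variable {τ τ' : Mesh}

/-- Two triangles that share an edge are on opposite sides of it. -/
lemma Nonoverlapping.nodal_opposite_neg (hτ : τ.Nonoverlapping) {T₁ T₂ : Tri} (h₁ : T₁ ∈ τ)
    (h₂ : T₂ ∈ τ) (hne : T₁ ≠ T₂) {e : Finset Plane} {p q p' q' r₁ r₂ : Plane}
    (hv₁ : T₁.EdgeVertices e p q r₁) (hv₂ : T₂.EdgeVertices e p' q' r₂) :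
    T₂.nodal r₂ r₁ < 0 := by
  have hn₁ := hτ.nondegenerate T₁ h₁
  have hn₂ := hτ.nondegenerate T₂ h₂
  have hz : ∀ v ∈ e, T₂.nodal r₂ v = 0 := fun v hv =>
    hn₂.nodal_of_ne (hv₂.subset_verts hv) fun h => hv₂.r_notMem (h ▸ hv)
  have hmul := hv₁.nodal_eq_mul hn₁ (hz p hv₁.p_mem) (hz q hv₁.q_mem)
  have hne0 : T₂.nodal r₂ r₁ ≠ 0 := by
    intro h0
    have := hmul r₂
    rw [h0, mul_zero, hn₂.nodal_self hv₂.r_mem_verts] at this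
    exact one_ne_zero this
  by_contra hge
  have hpos : 0 < T₂.nodal r₂ r₁ := lt_of_le_of_ne (not_lt.1 hge) hne0.symm
  -- Points close to the midpoint of the edge, on the side of `r₁`, are in both interiors.
  set m := midpoint ℝ p q
  have hm : ∀ T : Tri, T.Nondegenerate → e ⊆ T.verts → ∀ v ∈ e, T.nodal v m = 1 / 2 := by
    intro T hT he v hv
    have a1 := hT.nodal_self (he hv₁.p_mem)
    have a2 := hT.nodal_self (he hv₁.q_mem)
    have a3 := hT.nodal_of_ne (he hv₁.p_mem) hv₁.p_ne_q.symm
    have a4 := hT.nodal_of_ne (he hv₁.q_mem) hv₁.p_ne_q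
    rcases (hv₁.mem_edge v).1 hv with rfl | rfl <;> simp only [m, nodal_midpoint, a1, a2, a3, a4]
      <;> norm_num
  have hO : IsOpen (⋂ v ∈ e, {y | 0 < T₁.nodal v y} ∩ {y | 0 < T₂.nodal v y}) :=
    e.finite_toSet.isOpen_biInter fun v _ =>
      (isOpen_lt continuous_const (T₁.continuous_nodal v)).inter
        (isOpen_lt continuous_const (T₂.continuous_nodal v))
  have hmO : m ∈ ⋂ v ∈ e, {y | 0 < T₁.nodal v y} ∩ {y | 0 < T₂.nodal v y} := by
    simp only [Set.mem_iInter, Set.mem_inter_iff, Set.mem_ofPred_eq]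
    intro v hv
    rw [hm T₁ hn₁ hv₁.subset_verts v hv, hm T₂ hn₂ hv₂.subset_verts v hv]
    norm_num
  obtain ⟨t, ht0, _, ht⟩ := exists_lineMap_mem hO hmO r₁
  simp only [Set.mem_iInter, Set.mem_inter_iff, Set.mem_ofPred_eq] at ht
  have hr₁ : 0 < T₁.nodal r₁ (AffineMap.lineMap m r₁ t) := by
    rw [nodal_lineMap, hn₁.nodal_self hv₁.r_mem_verts, nodal_midpoint,
      hn₁.nodal_of_ne hv₁.p_mem_verts hv₁.p_ne_r.symm,
      hn₁.nodal_of_ne hv₁.q_mem_verts hv₁.q_ne_r.symm]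
    linarith
  have hr₂ : 0 < T₂.nodal r₂ (AffineMap.lineMap m r₁ t) := by
    rw [hmul]; exact mul_pos hr₁ hpos
  have i₁ := hn₁.mem_interior (x := AffineMap.lineMap m r₁ t) fun v hv => by
    rcases (hv₁.mem_tri v).1 hv with rfl | rfl | rfl
    exacts [(ht _ hv₁.p_mem).1, (ht _ hv₁.q_mem).1, hr₁]
  have i₂ := hn₂.mem_interior (x := AffineMap.lineMap m r₁ t) fun v hv => by
    rcases (hv₂.mem_tri v).1 hv with rfl | rfl | rfl
    exacts [(ht _ hv₂.p_mem).2, (ht _ hv₂.q_mem).2, hr₂]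
  exact Set.disjoint_left.1 (hτ.disjoint T₁ h₁ T₂ h₂ hne) i₁ i₂

/-- At most two triangles share an edge. -/
lemma Nonoverlapping.eq_or_eq_of_mem_edges (hτ : τ.Nonoverlapping) {T₁ T₂ T₃ : Tri} (h₁ : T₁ ∈ τ)
    (h₂ : T₂ ∈ τ) (h₃ : T₃ ∈ τ) (hne : T₁ ≠ T₂) {e : Finset Plane} (he₁ : e ∈ T₁.edges)
    (he₂ : e ∈ T₂.edges) (he₃ : e ∈ T₃.edges) : T₃ = T₁ ∨ T₃ = T₂ := by
  by_contra! hcon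
  obtain ⟨p₁, q₁, r₁, hv₁⟩ := (hτ.nondegenerate T₁ h₁).exists_edgeVertices he₁
  obtain ⟨p₂, q₂, r₂, hv₂⟩ := (hτ.nondegenerate T₂ h₂).exists_edgeVertices he₂
  obtain ⟨p₃, q₃, r₃, hv₃⟩ := (hτ.nondegenerate T₃ h₃).exists_edgeVertices he₃
  have h12 := hτ.nodal_opposite_neg h₁ h₂ hne hv₁ hv₂
  have h13 := hτ.nodal_opposite_neg h₁ h₃ hcon.1.symm hv₁ hv₃
  have h23 := hτ.nodal_opposite_neg h₂ h₃ hcon.2.symm hv₂ hv₃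
  have hz : ∀ v ∈ e, T₃.nodal r₃ v = 0 := fun v hv =>
    (hτ.nondegenerate T₃ h₃).nodal_of_ne (hv₃.subset_verts hv) fun h => hv₃.r_notMem (h ▸ hv)
  have := hv₂.nodal_eq_mul (hτ.nondegenerate T₂ h₂) (hz _ hv₂.p_mem) (hz _ hv₂.q_mem) r₁
  have := mul_pos_of_neg_of_neg h12 h23
  linarith

/-- The outer normals of two triangles on a shared edge are opposite. -/
lemma Nonoverlapping.outerNormal_eq_neg (hτ : τ.Nonoverlapping) {T₁ T₂ : Tri} (h₁ : T₁ ∈ τ)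
    (h₂ : T₂ ∈ τ) (hne : T₁ ≠ T₂) {e : Finset Plane} (he₁ : e ∈ T₁.edges) (he₂ : e ∈ T₂.edges) :
    T₂.outerNormal e = -T₁.outerNormal e := by
  have hn₁ := hτ.nondegenerate T₁ h₁
  have hn₂ := hτ.nondegenerate T₂ h₂
  obtain ⟨p, q, r₁, hv₁⟩ := hn₁.exists_edgeVertices he₁
  obtain ⟨p', q', r₂, hv₂⟩ := hn₂.exists_edgeVertices he₂
  have hn := hv₁.isOuterNormal_outerNormal hn₁
  obtain ⟨i1, i2, i3⟩ := hv₁.isOuterNormal_iff.1 hn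
  have hpq : inner ℝ (T₁.outerNormal e) (q' - p') = 0 := hn.2.1 p' hv₂.p_mem q' hv₂.q_mem
  have hpp : inner ℝ (T₁.outerNormal e) (p' - p) = 0 := hn.2.1 p hv₁.p_mem p' hv₂.p_mem
  refine hv₂.outerNormal_eq hn₂ (hv₂.isOuterNormal_iff.2 ⟨by rwa [norm_neg], ?_, ?_⟩)
  · rw [inner_neg_left, hpq, neg_zero]
  · have hneg := hτ.nodal_opposite_neg h₂ h₁ hne.symm hv₂ hv₁
    rw [inner_neg_left, ← sub_sub_sub_cancel_right r₂ p' p, inner_sub_right, hpp, sub_zero,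
      hv₁.inner_eq hn₁ i2 r₂]
    have := mul_nonneg_of_nonpos_of_nonpos hneg.le i3
    linarith

end Mesh

namespace Mesh

/-! ### Interior edges -/

open Tri

variable {τ τ' : Mesh}

/-- The edges that are shared by two triangles. -/
noncomputable def interiorEdges (τ : Mesh) : Finset (Finset Plane) := by
  classical
  exact {e ∈ τ.edges | ∃ T₁ ∈ τ, ∃ T₂ ∈ τ, T₁ ≠ T₂ ∧ e ∈ T₁.edges ∧ e ∈ T₂.edges}

lemma mem_edges {e : Finset Plane} : e ∈ τ.edges ↔ ∃ T ∈ τ, e ∈ T.edges := by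
  simp [edges]

lemma mem_interiorEdges {e : Finset Plane} : e ∈ τ.interiorEdges ↔
    ∃ T₁ ∈ τ, ∃ T₂ ∈ τ, T₁ ≠ T₂ ∧ e ∈ T₁.edges ∧ e ∈ T₂.edges := by
  classical
  simp only [interiorEdges, Finset.mem_filter, mem_edges, and_iff_right_iff_imp]
  rintro ⟨T, hT, -, -, -, he, -⟩
  exact ⟨T, hT, he⟩

lemma mem_patchEdges {e : Finset Plane} {z : Plane} : e ∈ τ.patchEdges z ↔ e ∈ τ.edges ∧
    convexHull ℝ (e : Set Plane) ⊆ τ.patch z ∧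
      ¬ convexHull ℝ (e : Set Plane) ⊆ frontier (τ.patch z) := by
  simp [patchEdges]

/-- When a point in the relative interior of an edge of `T` is in the interior of a patch, then
the edge is shared by another triangle in that patch. -/
lemma IsTriangulation.exists_neighbour (hτ : τ.IsTriangulation) {T : Tri} (hT : T ∈ τ)
    {e : Finset Plane} (he : e ∈ T.edges) {x z : Plane} (hx : x ∈ convexHull ℝ (e : Set Plane))
    (hxe : ∀ v ∈ e, τ.hat v x ≠ 0) (hxi : x ∈ interior (τ.patch z)) :
    ∃ T' ∈ τ, T' ≠ T ∧ z ∈ T'.verts ∧ e ∈ T'.edges ∧ ∀ v ∈ T.verts, v ∈ T'.verts → v ∈ e := by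
  have hn := hτ.nondegenerate T hT
  obtain ⟨p, q, r, hv⟩ := hn.exists_edgeVertices he
  obtain ⟨hxT, hxr⟩ := (hv.mem_convexHull hn).1 hx
  set O := interior (τ.patch z) ∩ ⋂ A ∈ {A ∈ (τ : Set Tri) | x ∉ A.carrier}, A.carrierᶜ
  have hO : IsOpen O := isOpen_interior.inter
    ((τ.finite_toSet.subset (Set.sep_subset _ _)).isOpen_biInter
      fun A _ => A.isClosed_carrier.isOpen_compl)
  have hxO : x ∈ O := ⟨hxi, by simp⟩
  -- Move from `x` away from `r`, that is, out of `T`.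
  obtain ⟨t, ht0, -, ht⟩ := exists_lineMap_mem hO hxO (AffineMap.lineMap x r (-1 : ℝ))
  set y : Plane := AffineMap.lineMap x (AffineMap.lineMap x r (-1 : ℝ)) t
  have hyT : y ∉ T.carrier := by
    intro hy
    have := hn.nodal_nonneg hy r
    rw [nodal_lineMap, nodal_lineMap, hxr, hn.nodal_self hv.r_mem_verts] at this
    linarith
  obtain ⟨T', hT', hz, hy⟩ := hτ.mem_patch.1 (interior_subset ht.1)
  have hxT' : x ∈ T'.carrier := by
    by_contra h
    exact Set.mem_iInter₂.1 ht.2 T' ⟨hT', h⟩ hy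
  have hsub : e ⊆ T'.verts := by
    intro v hve
    by_contra h
    exact hxe v hve (by rw [hτ.hat_eq hT' hxT', Tri.nodal_eq_zero h])
  refine ⟨T', hT', fun h => hyT (h ▸ hy), hz,
    (hτ.nondegenerate T' hT').mem_edges.2 ⟨hsub, hv.card⟩, fun v hvT hvT' => ?_⟩
  by_contra hve
  have hvr : v = r := by
    rcases (hv.mem_tri v).1 hvT with h | h | h
    exacts [absurd (h ▸ hv.p_mem) hve, absurd (h ▸ hv.q_mem) hve, h]
  have hall : T.verts ⊆ T'.verts := by
    intro w hw
    rcases (hv.mem_tri w).1 hw with h | h | h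
    exacts [hsub (h ▸ hv.p_mem), hsub (h ▸ hv.q_mem), h ▸ hvr ▸ hvT']
  have heq := Finset.eq_of_subset_of_card_le hall
    (by rw [hn.card_verts, (hτ.nondegenerate T' hT').card_verts])
  exact hyT (by rw [carrier, heq]; exact hy)

/-- The edges in the patch of `z` that are not on its boundary are the interior edges with
endpoint `z`. -/
lemma IsTriangulation.mem_patchEdges_iff (hτ : τ.IsTriangulation) {e : Finset Plane} {z : Plane} :
    e ∈ τ.patchEdges z ↔ e ∈ τ.interiorEdges ∧ z ∈ e := by
  rw [mem_patchEdges, mem_interiorEdges, mem_edges]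
  constructor
  · rintro ⟨⟨T, hT, he⟩, hsub, hfr⟩
    have hn := hτ.nondegenerate T hT
    obtain ⟨p, q, r, hv⟩ := hn.exists_edgeVertices he
    obtain ⟨x₀, hx₀, hx₀'⟩ := Set.not_subset.1 hfr
    have hx₀i : x₀ ∈ interior (τ.patch z) := by
      by_contra h
      exact hx₀' ⟨subset_closure (hsub hx₀), h⟩
    have hm : midpoint ℝ p q ∈ convexHull ℝ (e : Set Plane) :=
      (convex_convexHull ℝ _).midpoint_mem (subset_convexHull ℝ _ hv.p_mem)
        (subset_convexHull ℝ _ hv.q_mem)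
    obtain ⟨t, ht0, ht1, ht⟩ := exists_lineMap_mem isOpen_interior hx₀i (midpoint ℝ p q)
    set x : Plane := AffineMap.lineMap x₀ (midpoint ℝ p q) t
    have hx : x ∈ convexHull ℝ (e : Set Plane) :=
      (convex_convexHull ℝ _).segment_subset hx₀ hm
        (segment_eq_image_lineMap ℝ x₀ (midpoint ℝ p q) ▸ ⟨t, ⟨ht0.le, ht1.le⟩, rfl⟩)
    have hxe : ∀ v ∈ e, τ.hat v x ≠ 0 := by
      intro v hve
      rw [hτ.hat_eq hT ((hv.mem_convexHull hn).1 hx).1, nodal_lineMap, nodal_midpoint]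
      have h0 := mul_nonneg (sub_nonneg.2 ht1.le)
        (hn.nodal_nonneg ((hv.mem_convexHull hn).1 hx₀).1 v)
      have h1 : T.nodal v p + T.nodal v q = 1 := by
        rcases (hv.mem_edge v).1 hve with rfl | rfl
        · rw [hn.nodal_self hv.p_mem_verts, hn.nodal_of_ne hv.q_mem_verts hv.p_ne_q, add_zero]
        · rw [hn.nodal_self hv.q_mem_verts, hn.nodal_of_ne hv.p_mem_verts hv.p_ne_q.symm, zero_add]
      rw [h1]
      linarith
    -- The neighbour of `T` and the neighbour of that neighbour both contain `z`.
    obtain ⟨T', hT', hne, hz', he', -⟩ := hτ.exists_neighbour hT he hx hxe ht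
    obtain ⟨T'', hT'', -, hz'', -, hall⟩ := hτ.exists_neighbour hT' he' hx hxe ht
    exact ⟨⟨T, hT, T', hT', hne.symm, he, he'⟩, hall z hz' hz''⟩
  · rintro ⟨⟨T₁, h₁, T₂, h₂, hne, he₁, he₂⟩, hz⟩
    have hn₁ := hτ.nondegenerate T₁ h₁
    have hn₂ := hτ.nondegenerate T₂ h₂
    obtain ⟨p, q, r₁, hv₁⟩ := hn₁.exists_edgeVertices he₁
    obtain ⟨p₂, q₂, r₂, hv₂⟩ := hn₂.exists_edgeVertices he₂
    refine ⟨⟨T₁, h₁, he₁⟩, fun x hx => hτ.mem_patch.2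
      ⟨T₁, h₁, hv₁.subset_verts hz, ((hv₁.mem_convexHull hn₁).1 hx).1⟩, fun hfr => ?_⟩
    -- A neighbourhood of the midpoint of the edge is contained in the union of both triangles.
    set m := midpoint ℝ p q
    have hm : m ∈ convexHull ℝ (e : Set Plane) :=
      (convex_convexHull ℝ _).midpoint_mem (subset_convexHull ℝ _ hv₁.p_mem)
        (subset_convexHull ℝ _ hv₁.q_mem)
    refine (hfr hm).2 (mem_interior.2 ⟨⋂ v ∈ e, {y | 0 < T₁.nodal v y} ∩ {y | 0 < T₂.nodal v y},
      ?_, ?_, ?_⟩)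
    · intro y hy
      simp only [Set.mem_iInter, Set.mem_inter_iff, Set.mem_ofPred_eq] at hy
      have hzero : ∀ v ∈ e, T₂.nodal r₂ v = 0 := fun v hv =>
        hn₂.nodal_of_ne (hv₂.subset_verts hv) fun h => hv₂.r_notMem (h ▸ hv)
      have hmul := hv₁.nodal_eq_mul hn₁ (hzero _ hv₁.p_mem) (hzero _ hv₁.q_mem) y
      have hneg := hτ.nodal_opposite_neg h₁ h₂ hne hv₁ hv₂
      rcases le_total 0 (T₁.nodal r₁ y) with h | h
      · refine hτ.mem_patch.2 ⟨T₁, h₁, hv₁.subset_verts hz, hn₁.mem_carrier.2 fun v hv => ?_⟩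
        rcases (hv₁.mem_tri v).1 hv with rfl | rfl | rfl
        exacts [(hy _ hv₁.p_mem).1.le, (hy _ hv₁.q_mem).1.le, h]
      · refine hτ.mem_patch.2 ⟨T₂, h₂, hv₂.subset_verts hz, hn₂.mem_carrier.2 fun v hv => ?_⟩
        rcases (hv₂.mem_tri v).1 hv with rfl | rfl | rfl
        exacts [(hy _ hv₂.p_mem).2.le, (hy _ hv₂.q_mem).2.le,
          hmul ▸ mul_nonneg_of_nonpos_of_nonpos h hneg.le]
    · exact e.finite_toSet.isOpen_biInter fun v _ =>
        (isOpen_lt continuous_const (T₁.continuous_nodal v)).inter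
          (isOpen_lt continuous_const (T₂.continuous_nodal v))
    · simp only [Set.mem_iInter, Set.mem_inter_iff, Set.mem_ofPred_eq]
      intro v hv
      rw [nodal_midpoint, nodal_midpoint, hn₁.nodal_vertex v hv₁.p_mem_verts,
        hn₁.nodal_vertex v hv₁.q_mem_verts, hn₂.nodal_vertex v (hv₂.subset_verts hv₁.p_mem),
        hn₂.nodal_vertex v (hv₂.subset_verts hv₁.q_mem)]
      rcases (hv₁.mem_edge v).1 hv with rfl | rfl <;>
        simp [hv₁.p_ne_q, hv₁.p_ne_q.symm]

lemma IsTriangulation.subset_nodes (hτ : τ.IsTriangulation) {e : Finset Plane}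
    (he : e ∈ τ.interiorEdges) : e ⊆ τ.nodes := by
  obtain ⟨T, hT, -, -, -, he, -⟩ := mem_interiorEdges.1 he
  exact fun v hv => mem_nodes.2
    ⟨T, hT, ((hτ.nondegenerate T hT).mem_edges.1 he).1 hv⟩

/-- Sums over the nodes and the edges of their patches, rearranged into sums over the interior edges
and their endpoints. -/
lemma IsTriangulation.sum_patchEdges (hτ : τ.IsTriangulation) (w : Plane → ℝ)
    (F : Finset Plane → ℝ) : ∑ z ∈ τ.nodes, w z * ∑ e ∈ τ.patchEdges z, F e =
      ∑ e ∈ τ.interiorEdges, (∑ z ∈ e, w z) * F e := by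
  simp_rw [Finset.mul_sum, Finset.sum_mul]
  refine Finset.sum_comm' fun z e => ?_
  rw [hτ.mem_patchEdges_iff]
  exact ⟨fun h => ⟨h.2.2, h.2.1⟩, fun h => ⟨hτ.subset_nodes h.2 h.1, h.2, h.1⟩⟩

/-! ### The edges inside a coarse edge -/

/-- A hat function vanishes on the edges that do not contain its node. -/
lemma IsTriangulation.hat_eq_zero_of_notMem (hτ : τ.IsTriangulation) {e : Finset Plane}
    (he : e ∈ τ.edges) {x v : Plane} (hx : x ∈ convexHull ℝ (e : Set Plane)) (hv : v ∉ e) :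
    τ.hat v x = 0 := by
  obtain ⟨T, hT, he⟩ := mem_edges.1 he
  have hn := hτ.nondegenerate T hT
  have hs := (hn.mem_edges.1 he).1
  have hx' := (hn.mem_convexHull hs).1 hx
  rw [hτ.hat_eq hT (convexHull_mono (by exact_mod_cast hs) hx)]
  by_cases hvT : v ∈ T.verts
  · exact hx'.2 v hvT hv
  · exact Tri.nodal_eq_zero hvT x

lemma IsTriangulation.subsingleton_inter (hτ : τ.IsTriangulation) {e₁ e₂ : Finset Plane}
    (h₁ : e₁ ∈ τ.edges) (h₂ : e₂ ∈ τ.edges) (hne : e₁ ≠ e₂) :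
    (convexHull ℝ (e₁ : Set Plane) ∩ convexHull ℝ (e₂ : Set Plane)).Subsingleton := by
  obtain ⟨T, hT, he₁⟩ := mem_edges.1 h₁
  obtain ⟨T₂, hT₂, he₂⟩ := mem_edges.1 h₂
  have hn := hτ.nondegenerate T hT
  have hc := (hn.mem_edges.1 he₁).2
  have hc₂ := ((hτ.nondegenerate T₂ hT₂).mem_edges.1 he₂).2
  have : ∃ v ∈ e₁, v ∉ e₂ := by
    by_contra! h
    exact hne (Finset.eq_of_subset_of_card_le h (by rw [hc, hc₂]))
  obtain ⟨v, hv, hv₂⟩ := this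
  obtain ⟨p, q, r, hV⟩ := hn.exists_edgeVertices he₁
  wlog hvp : v = p generalizing p q
  · exact this q p hV.swap (((hV.mem_edge v).1 hv).resolve_left hvp)
  subst hvp
  have key : ∀ x ∈ convexHull ℝ (e₁ : Set Plane) ∩ convexHull ℝ (e₂ : Set Plane), x = q := by
    rintro x ⟨hx, hx₂⟩
    obtain ⟨hxT, hxr⟩ := (hV.mem_convexHull hn).1 hx
    have h0 := hτ.hat_eq_zero_of_notMem h₂ hx₂ hv₂
    rw [hτ.hat_eq hT hxT] at h0
    have h1 := hV.sum_nodal hn x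
    have h2 := hV.sum_nodal_smul hn x
    rw [h0, hxr, zero_add, add_zero] at h1
    rw [h0, hxr, h1, zero_smul, zero_smul, one_smul, zero_add, add_zero] at h2
    exact h2.symm
  exact fun x hx y hy => (key x hx).trans (key y hy).symm

/-- The one-dimensional measure of an edge is its length. -/
lemma IsTriangulation.hausdorffMeasure_edge (hτ : τ.IsTriangulation) {e : Finset Plane}
    (he : e ∈ τ.edges) : Measure.hausdorffMeasure 1 (convexHull ℝ (e : Set Plane)) =
      ENNReal.ofReal (Metric.diam (e : Set Plane)) := by
  obtain ⟨T, hT, he⟩ := mem_edges.1 he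
  obtain ⟨p, q, r, hV⟩ := (hτ.nondegenerate T hT).exists_edgeVertices he
  rw [hV.diam_eq, hV.eq_pair, convexHull_pair, hausdorffMeasure_segment, edist_dist]

/-- The total length of different edges inside a segment is at most the length of that segment. -/
lemma IsTriangulation.sum_diam_le (hτ : τ.IsTriangulation) (hτ' : τ'.IsTriangulation)
    {e : Finset Plane} (he : e ∈ τ.edges) {F : Finset (Finset Plane)} (hF : F ⊆ τ'.edges)
    (hFe : ∀ e' ∈ F, (e' : Set Plane) ⊆ convexHull ℝ (e : Set Plane)) :
    ∑ e' ∈ F, Metric.diam (e' : Set Plane) ≤ Metric.diam (e : Set Plane) := by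
  have hle : ∑ e' ∈ F, Measure.hausdorffMeasure 1 (convexHull ℝ (e' : Set Plane)) ≤
      Measure.hausdorffMeasure 1 (convexHull ℝ (e : Set Plane)) := by
    rw [← measure_biUnion_finset₀]
    · exact measure_mono (Set.iUnion₂_subset fun e' he' =>
        convexHull_min (hFe e' he') (convex_convexHull ℝ _))
    · intro e₁ h₁ e₂ h₂ hne
      have := Measure.nullSingletonClass_hausdorff Plane (d := 1) one_pos
      exact (hτ'.subsingleton_inter (hF h₁) (hF h₂) hne).measure_zero _
    · intro e' _
      exact (e'.finite_toSet.isCompact_convexHull (𝕜 := ℝ)).isClosed.measurableSet.nullMeasurableSet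
  rw [hτ.hausdorffMeasure_edge he, Finset.sum_congr rfl fun e' he' =>
    hτ'.hausdorffMeasure_edge (hF he'),
    ← ENNReal.ofReal_sum_of_nonneg fun _ _ => Metric.diam_nonneg] at hle
  exact (ENNReal.ofReal_le_ofReal_iff Metric.diam_nonneg).1 hle

/-- The edges inside a coarse edge with a marked endpoint are at most half as long. -/
lemma IsTriangulation.diam_le_half (hτ : τ.IsTriangulation) (hτ' : τ'.IsTriangulation)
    (h : τ'.Refines τ) {M : Finset Plane} (hM : τ.FourfoldRefined M τ') {e e' : Finset Plane}
    (he : e ∈ τ.edges) (he' : e' ∈ τ'.edges)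
    (hee' : (e' : Set Plane) ⊆ convexHull ℝ (e : Set Plane)) {z : Plane} (hz : z ∈ e)
    (hzM : z ∈ M) : Metric.diam (e' : Set Plane) ≤ 1 / 2 * Metric.diam (e : Set Plane) := by
  obtain ⟨T₀, hT₀, he₀⟩ := mem_edges.1 he
  obtain ⟨T', hT', heT'⟩ := mem_edges.1 he'
  obtain ⟨T, hT, hs⟩ := h.exists_superset hT'
  have hn₀ := hτ.nondegenerate T₀ hT₀
  have hn := hτ.nondegenerate T hT
  obtain ⟨p, q, r, hV⟩ := hn₀.exists_edgeVertices he₀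
  obtain ⟨p', q', r', hV'⟩ := (hτ'.nondegenerate T' hT').exists_edgeVertices heT'
  have hp' := hee' hV'.p_mem
  have hq' := hee' hV'.q_mem
  have hpT := hs (subset_carrier hV'.p_mem_verts)
  have hqT := hs (subset_carrier hV'.q_mem_verts)
  obtain ⟨hp₀, hpr⟩ := (hV.mem_convexHull hn₀).1 hp'
  obtain ⟨hq₀, hqr⟩ := (hV.mem_convexHull hn₀).1 hq'
  -- As `p'` and `q'` are different, neither endpoint of `e` has a hat function that vanishes at
  -- both, so that both endpoints are vertices of `T`.
  have hend : ∀ {a b : Plane}, T₀.EdgeVertices e a b r → a ∈ T.verts := by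
    intro a b hab
    by_contra ha
    have e1 : T₀.nodal a p' = 0 := by
      rw [← hτ.hat_eq hT₀ hp₀, hτ.hat_eq hT hpT, Tri.nodal_eq_zero ha]
    have e2 : T₀.nodal a q' = 0 := by
      rw [← hτ.hat_eq hT₀ hq₀, hτ.hat_eq hT hqT, Tri.nodal_eq_zero ha]
    have := hab.dist_eq hn₀ hp' hq'
    rw [e1, e2, sub_self, abs_zero, zero_mul] at this
    exact hV'.p_ne_q (dist_eq_zero.1 this)
  have hsub : e ⊆ T.verts := by
    intro v hv
    rcases (hV.mem_edge v).1 hv with rfl | rfl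
    exacts [hend hV, hend hV.swap]
  obtain ⟨a, b, c, hab⟩ := hn.exists_edgeVertices (hn.mem_edges.2 ⟨hsub, hV.card⟩)
  obtain ⟨G, hG, hsG⟩ := hM z hzM T (hτ.mem_patchTris_iff.2 ⟨hT, hsub hz⟩) T' hT' hs
  rw [hV'.diam_eq]
  exact hab.dist_le_half hn hG hp' hq' (hsG (subset_carrier hV'.p_mem_verts))
    (hsG (subset_carrier hV'.q_mem_verts))

/-- The squared lengths of the edges inside a coarse edge. -/
lemma IsTriangulation.sum_sq_diam_le (hτ : τ.IsTriangulation) (hτ' : τ'.IsTriangulation)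
    (h : τ'.Refines τ) {M : Finset Plane} (hM : τ.FourfoldRefined M τ') {e : Finset Plane}
    (he : e ∈ τ.edges) {F : Finset (Finset Plane)} (hF : F ⊆ τ'.edges)
    (hFe : ∀ e' ∈ F, (e' : Set Plane) ⊆ convexHull ℝ (e : Set Plane)) :
    2 * ∑ e' ∈ F, Metric.diam (e' : Set Plane) ^ 2 ≤
      (∑ z ∈ e, weight M z) * Metric.diam (e : Set Plane) ^ 2 := by
  classical
  set d := Metric.diam (e : Set Plane)
  have hd : 0 ≤ d := Metric.diam_nonneg
  have hsum := hτ.sum_diam_le hτ' he hF hFe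
  have hbound : ∀ c, 0 ≤ c → (∀ e' ∈ F, Metric.diam (e' : Set Plane) ≤ c * d) →
      ∑ e' ∈ F, Metric.diam (e' : Set Plane) ^ 2 ≤ c * d ^ 2 := by
    intro c hc hle
    calc ∑ e' ∈ F, Metric.diam (e' : Set Plane) ^ 2
        ≤ ∑ e' ∈ F, c * d * Metric.diam (e' : Set Plane) := Finset.sum_le_sum fun e' he' => by
          rw [sq]; exact mul_le_mul_of_nonneg_right (hle e' he') Metric.diam_nonneg
      _ = c * d * ∑ e' ∈ F, Metric.diam (e' : Set Plane) := by rw [Finset.mul_sum]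
      _ ≤ c * d * d := mul_le_mul_of_nonneg_left hsum (mul_nonneg hc hd)
      _ = c * d ^ 2 := by ring
  have hcard : e.card = 2 := by
    obtain ⟨T, hT, he⟩ := mem_edges.1 he
    exact ((hτ.nondegenerate T hT).mem_edges.1 he).2
  by_cases hz : ∃ z ∈ e, z ∈ M
  · obtain ⟨z, hz, hzM⟩ := hz
    have h1 := hbound (1 / 2) (by norm_num) fun e' he' =>
      hτ.diam_le_half hτ' h hM he (hF he') (hFe e' he') hz hzM
    have h2 : 1 ≤ ∑ z ∈ e, weight M z := by
      have : ∑ z ∈ e, (1 / 2 : ℝ) ≤ ∑ z ∈ e, weight M z := Finset.sum_le_sum fun z _ => by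
        unfold weight; split_ifs <;> norm_num
      rw [Finset.sum_const, hcard] at this
      norm_num at this
      exact this
    have := mul_le_mul_of_nonneg_right h2 (sq_nonneg d)
    linarith
  · push Not at hz
    have h1 := hbound 1 zero_le_one fun e' he' => by
      rw [one_mul]
      exact (Finset.single_le_sum (f := fun e' : Finset Plane => Metric.diam (e' : Set Plane))
        (fun _ _ => Metric.diam_nonneg) he').trans hsum
    have h2 : ∑ z ∈ e, weight M z = 2 := by
      rw [Finset.sum_congr rfl fun z hz' => show weight M z = 1 from if_neg (hz z hz'),
        Finset.sum_const, hcard]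
      norm_num
    rw [h2]
    linarith

end Mesh

/-! ### Jumps under refinement -/

lemma IsAffineOn.mono {U : Plane → ℝ} {T T' : Tri} {g : Plane} (h : IsAffineOn U T g)
    (hs : T'.carrier ⊆ T.carrier) : IsAffineOn U T' g := by
  obtain ⟨c, hc⟩ := h
  exact ⟨c, ae_restrict_of_ae_restrict_of_subset hs hc⟩

lemma IsAffineOn.unique {U : Plane → ℝ} {T : Tri} (hT : T.Nondegenerate) {g g' : Plane}
    (h : IsAffineOn U T g) (h' : IsAffineOn U T g') : g = g' := by
  obtain ⟨c, hc⟩ := h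
  obtain ⟨c', hc'⟩ := h'
  have hae : (fun x : Plane => inner ℝ g x + c) =ᵐ[volume.restrict (interior T.carrier)]
      fun x => inner ℝ g' x + c' := by
    refine ae_restrict_of_ae_restrict_of_subset interior_subset ?_
    filter_upwards [hc, hc'] with x h1 h2
    rw [← h1, h2]
  have heq := Measure.eqOn_open_of_ae_eq hae isOpen_interior (by fun_prop) (by fun_prop)
  obtain ⟨t, ht0, -, ht⟩ := exists_lineMap_mem isOpen_interior hT.centroid_mem_interior
    (T.centroid + (g - g'))
  have e1 : inner ℝ g T.centroid + c = inner ℝ g' T.centroid + c' :=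
    heq hT.centroid_mem_interior
  have e2 := heq ht
  simp only [AffineMap.lineMap_apply, vsub_eq_sub, vadd_eq_add, add_sub_cancel_left,
    inner_add_right, inner_smul_right] at e2
  have e3 : t * inner ℝ (g - g') (g - g') = 0 := by
    rw [inner_sub_left]
    linarith
  exact sub_eq_zero.1 (inner_self_eq_zero.1 ((mul_eq_zero.1 e3).resolve_left ht0.ne'))

lemma gradOn_eq {U : Plane → ℝ} {T : Tri} (hT : T.Nondegenerate) {g : Plane}
    (h : IsAffineOn U T g) : gradOn U T = g :=
  IsAffineOn.unique hT (Classical.epsilon_spec ⟨g, h⟩) h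

open Mesh in
lemma normalJump_eq (U : Plane → ℝ) {τ : Mesh} (hτ : τ.Nonoverlapping) {T₁ T₂ : Tri} (h₁ : T₁ ∈ τ)
    (h₂ : T₂ ∈ τ) (hne : T₁ ≠ T₂) {e : Finset Plane} (he₁ : e ∈ T₁.edges) (he₂ : e ∈ T₂.edges) :
    normalJump U τ e =
      inner ℝ (gradOn U T₁) (T₁.outerNormal e) + inner ℝ (gradOn U T₂) (T₂.outerNormal e) := by
  classical
  rw [normalJump, ← Finset.sum_pair (f := fun T : Tri => inner ℝ (gradOn U T) (T.outerNormal e)) hne]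
  refine Finset.sum_congr ?_ fun _ _ => rfl
  ext T
  simp only [Finset.mem_filter, Finset.mem_insert, Finset.mem_singleton]
  constructor
  · rintro ⟨hT, he⟩
    exact hτ.eq_or_eq_of_mem_edges h₁ h₂ hT hne he₁ he₂ he
  · rintro (rfl | rfl)
    exacts [⟨h₁, he₁⟩, ⟨h₂, he₂⟩]

open Mesh in
/-- For a piecewise affine function w.r.t. a coarse triangulation, the jump over a fine edge
vanishes, or that edge is part of a coarse edge with the same jump. -/
lemma normalJump_refines {U : Plane → ℝ} {τ τ' : Mesh} (hτ : τ.IsTriangulation)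
    (hτ' : τ'.IsTriangulation) (h : τ'.Refines τ) (hU : ∀ T ∈ τ, ∃ g, IsAffineOn U T g)
    {e' : Finset Plane} (he' : e' ∈ τ'.interiorEdges) : normalJump U τ' e' = 0 ∨
      ∃ e ∈ τ.interiorEdges, (e' : Set Plane) ⊆ convexHull ℝ (e : Set Plane) ∧
        normalJump U τ' e' = normalJump U τ e := by
  classical
  obtain ⟨T₁, h₁, T₂, h₂, hne, he₁, he₂⟩ := mem_interiorEdges.1 he'
  obtain ⟨P₁, hP₁, hs₁⟩ := h.exists_superset h₁
  obtain ⟨P₂, hP₂, hs₂⟩ := h.exists_superset h₂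
  have hn₁ := hτ'.nondegenerate T₁ h₁
  have hn₂ := hτ'.nondegenerate T₂ h₂
  have hN₁ := hτ.nondegenerate P₁ hP₁
  have hN₂ := hτ.nondegenerate P₂ hP₂
  obtain ⟨g₁, hg₁⟩ := hU P₁ hP₁
  obtain ⟨g₂, hg₂⟩ := hU P₂ hP₂
  have hjump := normalJump_eq U hτ'.toNonoverlapping h₁ h₂ hne he₁ he₂
  rw [gradOn_eq hn₁ (hg₁.mono hs₁), gradOn_eq hn₂ (hg₂.mono hs₂)] at hjump
  by_cases hP : P₁ = P₂
  · subst hP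
    left
    rw [hjump, IsAffineOn.unique hN₁ hg₂ hg₁, hτ'.outerNormal_eq_neg h₁ h₂ hne he₁ he₂,
      inner_neg_right, add_neg_cancel]
  right
  set e := P₁.verts ∩ P₂.verts
  have hsub : (e' : Set Plane) ⊆ convexHull ℝ (e : Set Plane) := by
    intro x hx
    have hx₁ := hs₁ (Tri.subset_carrier ((hn₁.mem_edges.1 he₁).1 hx))
    have hx₂ := hs₂ (Tri.subset_carrier ((hn₂.mem_edges.1 he₂).1 hx))
    rw [Finset.coe_inter, ← hτ.conforming P₁ hP₁ P₂ hP₂ hP]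
    exact ⟨hx₁, hx₂⟩
  have hcard : e.card = 2 := by
    have hle : e.card ≤ 3 := hN₁.card_verts ▸ Finset.card_le_card Finset.inter_subset_left
    have hne3 : e.card ≠ 3 := by
      intro h3
      have e1 : e = P₁.verts := Finset.eq_of_subset_of_card_le Finset.inter_subset_left
        (by rw [h3, hN₁.card_verts])
      have e2 : e = P₂.verts := Finset.eq_of_subset_of_card_le Finset.inter_subset_right
        (by rw [h3, hN₂.card_verts])
      have : P₁.carrier = P₂.carrier := by rw [Tri.carrier, Tri.carrier, ← e1, ← e2]
      exact hP (hτ.eq_of_subset hP₁ hP₂ hN₁ subset_rfl this.le)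
    have hgt : ¬ e.card ≤ 1 := by
      intro h1
      have hss : (convexHull ℝ (e : Set Plane)).Subsingleton := by
        rw [Finset.card_le_one_iff_subset_singleton] at h1
        obtain ⟨s, hs⟩ := h1
        refine Set.subsingleton_singleton.anti (t := {s}) ?_
        exact convexHull_min (by exact_mod_cast hs) (convex_singleton s)
      obtain ⟨p, q, r, hV⟩ := hn₁.exists_edgeVertices he₁
      exact hV.p_ne_q (hss (hsub hV.p_mem) (hsub hV.q_mem))
    omega
  have hE₁ : e ∈ P₁.edges := hN₁.mem_edges.2 ⟨Finset.inter_subset_left, hcard⟩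
  have hE₂ : e ∈ P₂.edges := hN₂.mem_edges.2 ⟨Finset.inter_subset_right, hcard⟩
  refine ⟨e, mem_interiorEdges.2 ⟨P₁, hP₁, P₂, hP₂, hP, hE₁, hE₂⟩, hsub, ?_⟩
  obtain ⟨_, _, _, hV₁⟩ := hN₁.exists_edgeVertices hE₁
  obtain ⟨_, _, _, hV₂⟩ := hN₂.exists_edgeVertices hE₂
  rw [hjump, normalJump_eq U hτ.toNonoverlapping hP₁ hP₂ hP hE₁ hE₂, gradOn_eq hN₁ hg₁,
    gradOn_eq hN₂ hg₂, hV₁.outerNormal_eq_of_subset hN₁ hn₁ he₁ hs₁ hsub,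
    hV₂.outerNormal_eq_of_subset hN₂ hn₂ he₂ hs₂ hsub]

/-! ### Reduction of the error estimator -/

open Mesh

lemma sq_jumpLoc (U : Plane → ℝ) (τ : Mesh) (z : Plane) : jumpLoc U τ z ^ 2 =
    ∑ e ∈ τ.patchEdges z, Metric.diam (e : Set Plane) ^ 2 * normalJump U τ e ^ 2 :=
  Real.sq_sqrt (Finset.sum_nonneg fun _ _ => by positivity)

lemma sum_sq_jumpLoc_le {U : Plane → ℝ} {τ τ' : Mesh} (hτ : τ.IsTriangulation)
    (hτ' : τ'.IsTriangulation) (h : τ'.Refines τ) (hU : ∀ T ∈ τ, ∃ g, IsAffineOn U T g)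
    {M : Finset Plane} (hM : τ.FourfoldRefined M τ') :
    ∑ z ∈ τ'.nodes, jumpLoc U τ' z ^ 2 ≤ ∑ z ∈ τ.nodes, weight M z * jumpLoc U τ z ^ 2 := by
  classical
  have edge_of_interior : ∀ {σ : Mesh} {e}, e ∈ σ.interiorEdges → e ∈ σ.edges := fun he => by
    obtain ⟨T, hT, -, -, -, he, -⟩ := mem_interiorEdges.1 he
    exact mem_edges.2 ⟨T, hT, he⟩
  have hl := hτ'.sum_patchEdges (fun _ => 1)
    fun e => Metric.diam (e : Set Plane) ^ 2 * normalJump U τ' e ^ 2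
  simp only [one_mul] at hl
  simp_rw [sq_jumpLoc]
  rw [hl, hτ.sum_patchEdges]
  set I := {e' ∈ τ'.interiorEdges | normalJump U τ' e' ≠ 0}
  have hpar : ∀ e', ∃ e, e' ∈ I → e ∈ τ.interiorEdges ∧
      (e' : Set Plane) ⊆ convexHull ℝ (e : Set Plane) ∧
        normalJump U τ' e' = normalJump U τ e := by
    intro e'
    by_cases he' : e' ∈ I
    · obtain ⟨h1, h2⟩ := Finset.mem_filter.1 he'
      obtain ⟨e, he⟩ := (normalJump_refines hτ hτ' h hU h1).resolve_left h2
      exact ⟨e, fun _ => he⟩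
    · exact ⟨∅, fun h => absurd h he'⟩
  choose π hπ using hpar
  calc ∑ e' ∈ τ'.interiorEdges,
        (∑ _z ∈ e', (1 : ℝ)) * (Metric.diam (e' : Set Plane) ^ 2 * normalJump U τ' e' ^ 2)
      = ∑ e' ∈ τ'.interiorEdges,
        2 * (Metric.diam (e' : Set Plane) ^ 2 * normalJump U τ' e' ^ 2) := by
        refine Finset.sum_congr rfl fun e' he' => ?_
        obtain ⟨T, hT, he⟩ := mem_edges.1 (edge_of_interior he')
        rw [Finset.sum_const, ((hτ'.nondegenerate T hT).mem_edges.1 he).2]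
        norm_num
    _ = ∑ e' ∈ I, 2 * (Metric.diam (e' : Set Plane) ^ 2 * normalJump U τ' e' ^ 2) := by
        refine (Finset.sum_filter_of_ne (p := fun e' => normalJump U τ' e' ≠ 0)
          fun e' _ hne h0 => hne ?_).symm
        rw [h0]; ring
    _ = ∑ e ∈ τ.interiorEdges, ∑ e' ∈ I with π e' = e,
          2 * (Metric.diam (e' : Set Plane) ^ 2 * normalJump U τ' e' ^ 2) :=
        (Finset.sum_fiberwise_of_maps_to (fun e' he' => (hπ e' he').1) _).symm
    _ ≤ ∑ e ∈ τ.interiorEdges, (∑ z ∈ e, weight M z) *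
          (Metric.diam (e : Set Plane) ^ 2 * normalJump U τ e ^ 2) := by
        refine Finset.sum_le_sum fun e he => ?_
        have hfib : ∀ e' ∈ {e' ∈ I | π e' = e}, e' ∈ τ'.edges ∧
            (e' : Set Plane) ⊆ convexHull ℝ (e : Set Plane) ∧
              normalJump U τ' e' = normalJump U τ e := by
          intro e' he'
          obtain ⟨h1, rfl⟩ := Finset.mem_filter.1 he'
          exact ⟨edge_of_interior (Finset.mem_filter.1 h1).1, (hπ e' h1).2⟩
        have key := hτ.sum_sq_diam_le hτ' h hM (edge_of_interior he) (fun e' he' => (hfib e' he').1)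
          fun e' he' => (hfib e' he').2.1
        calc ∑ e' ∈ I with π e' = e,
              2 * (Metric.diam (e' : Set Plane) ^ 2 * normalJump U τ' e' ^ 2)
            = (2 * ∑ e' ∈ I with π e' = e, Metric.diam (e' : Set Plane) ^ 2) *
                normalJump U τ e ^ 2 := by
              rw [Finset.mul_sum, Finset.sum_mul]
              exact Finset.sum_congr rfl fun e' he' => by rw [(hfib e' he').2.2]; ring
          _ ≤ (∑ z ∈ e, weight M z) * Metric.diam (e : Set Plane) ^ 2 * normalJump U τ e ^ 2 :=
              mul_le_mul_of_nonneg_right key (sq_nonneg _)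
          _ = _ := mul_assoc _ _ _

lemma sq_estLoc (Ω γ : Set Plane) (U f χ : Plane → ℝ) (τ : Mesh) (z : Plane) :
    estLoc Ω γ U f χ τ z ^ 2 =
      jumpLoc U τ z ^ 2 + dOmegaLoc Ω f τ z ^ 2 + dGammaLoc γ χ τ z ^ 2 :=
  Real.sq_sqrt (by positivity)

lemma sq_estimator (Ω γ : Set Plane) (U f χ : Plane → ℝ) (τ : Mesh) (M : Finset Plane) :
    estimator Ω γ U f χ τ M ^ 2 = ∑ z ∈ M, estLoc Ω γ U f χ τ z ^ 2 :=
  Real.sq_sqrt (Finset.sum_nonneg fun _ _ => sq_nonneg _)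

lemma sum_weight_mul {τ : Mesh} {M : Finset Plane} (hM : M ⊆ τ.nodes) (F : Plane → ℝ) :
    ∑ z ∈ τ.nodes, weight M z * F z = ∑ z ∈ τ.nodes, F z - 1 / 2 * ∑ z ∈ M, F z := by
  classical
  rw [← Finset.sum_sdiff hM, ← Finset.sum_sdiff hM (f := F),
    Finset.sum_congr rfl fun z hz => show weight M z * F z = F z by
      rw [weight, if_neg (Finset.mem_sdiff.1 hz).2, one_mul],
    Finset.sum_congr (s₁ := M) rfl fun z hz => show weight M z * F z = 1 / 2 * F z by
      rw [weight, if_pos hz], ← Finset.mul_sum]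
  ring

lemma weight_empty (z : Plane) : weight ∅ z = 1 := if_neg (Finset.notMem_empty z)

theorem lemma7p5 (Ω γ : Set Plane) (hΩ : IsOpen Ω) (hγ : MeasurableSet γ) (hγΩ : γ ⊆ Ω)
    (τ₀ : Mesh) (hτ₀ : Mesh.IsBottom Ω τ₀)
    (f χ : Plane → ℝ) (hf : MemLp f 2 (volume.restrict Ω))
    (hχ : MemLp χ 2 ((Measure.hausdorffMeasure 1).restrict γ))
    (τ : Mesh) (hτ : τ ∈ Mesh.Family τ₀) :
    (∀ M : Finset Plane, M ⊆ τ.nodes → ∀ U ∈ feSpace Ω τ,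
      ∀ ρ : Mesh, Mesh.IsRefine τ₀ τ M ρ → ∀ τ' ∈ Mesh.Family τ₀, τ'.Refines ρ →
        estimator Ω γ U f χ τ' τ'.nodes ^ 2 ≤
          estimator Ω γ U f χ τ τ.nodes ^ 2 - 1 / 2 * estimator Ω γ U f χ τ M ^ 2) ∧
    (∀ τ' ∈ Mesh.Family τ₀, τ'.Refines τ →
      dataOscillation Ω γ f χ τ' τ'.nodes ≤ dataOscillation Ω γ f χ τ τ.nodes) := by
  have hfam : ∀ σ ∈ Family τ₀, σ.IsTriangulation := fun σ hσ =>
    ⟨hσ.1.nonoverlapping hτ₀.nonoverlapping, hσ.2⟩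
  have hT := hfam τ hτ
  have hcover : ∀ x ∈ Ω, ∃ T ∈ τ, x ∈ T.carrier := fun x hx => by
    refine hτ.1.exists_mem hτ₀.nonoverlapping ?_
    have : x ∈ ⋃ T ∈ τ₀, T.carrier := hτ₀.cover ▸ subset_closure hx
    simpa using this
  refine ⟨fun M hM U hU ρ hρ τ' hτ' href => ?_, fun τ' hτ' href => ?_⟩
  · have hT' := hfam τ' hτ'
    have href' : τ'.Refines τ := Relation.ReflTransGen.trans hρ.1.2.1 href
    have hfour := hρ.1.2.2.refines hT.toNonoverlapping hρ.1.2.1 href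
    simp_rw [sq_estimator]
    rw [← sum_weight_mul hM]
    simp_rw [sq_estLoc, mul_add, Finset.sum_add_distrib]
    exact add_le_add (add_le_add (sum_sq_jumpLoc_le hT hT' href' hU.2 hfour)
      (sum_sq_dOmegaLoc_le hΩ.measurableSet hf hT hcover hT' href' hfour))
      (sum_sq_dGammaLoc_le hγ hχ hT (fun x hx => hcover x (hγΩ hx)) hT' href' hfour)
  · have hT' := hfam τ' hτ'
    have hfour : τ.FourfoldRefined ∅ τ' := fun z hz => absurd hz (Finset.notMem_empty z)
    have h1 := sum_sq_dOmegaLoc_le hΩ.measurableSet hf hT hcover hT' href hfour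
    have h2 := sum_sq_dGammaLoc_le hγ hχ hT (fun x hx => hcover x (hγΩ hx)) hT' href hfour
    simp_rw [weight_empty, one_mul] at h1 h2
    have hsq : ∀ (s : Finset Plane) (F : Plane → ℝ), √(∑ z ∈ s, F z ^ 2) ^ 2 = ∑ z ∈ s, F z ^ 2 :=
      fun s F => Real.sq_sqrt (Finset.sum_nonneg fun _ _ => sq_nonneg _)
    refine Real.sqrt_le_sqrt ?_
    simp only [oscOmega, oscGamma, hsq]
    exact add_le_add h1 h2
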